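/- Let $Q(w)=w_1^2-w_2^2-w_3^2-w_4^2$ on row vectors in $\mathbb R^4$, let $\mathbb H^3=\{w : Q(w)=1,\ w_1>0\}$ with the hyperbolic metric $\cosh d(p,q)=p_1q_1-p_2q_2-p_3q_3-p_4q_4$, and let $\mathbb H^2=\{w\in\mathbb H^3 : w_4=0\}$. Let $G=\mathrm{SO}(3,1)^0$ be the identity component of $\{g\in \mathrm{SL}_4(\mathbb R): Q(wg)=Q(w)\ \forall w\}$, acting on $\mathbb H^3$ from the right. For a positive integer $A_1\equiv 1 \pmod 8$ put $Q_1(x)=7x_1^2-x_2^2-x_3^2-A_1x_4^2$ and $g_1=\mathrm{diag}(\sqrt7,1,1,\sqrt{A_1})$, and let $$\Gamma_1 = G\cap g_1^{-1}\{\gamma\in \mathrm{SL}_4(\mathbb Z) : \gamma\equiv I \ (\mathrm{mod}\ 7),\ Q_1(w\gamma)=Q_1(w)\ \forall w\}\,g_1 .$$ Let $M_1=\mathbb H^3/\Gamma_1$ with the quotient metric, $\rho_1:\mathbb H^3\to M_1$ the projection, and $V_1=\rho_1(\mathbb H^2)$. There is an absolute constant $C$ (independent of $A_1$ and $\zeta$)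 such that the following holds for every such $A_1$. Let $\zeta:\mathbb H^2\to M_1$ be a locally isometric immersion, that is, every point of $\mathbb H^2$ has a neighbourhood on which $\zeta$ preserves distances. Then: 1. $\zeta^{-1}(V_1)$ is a union of hyperbolic lines (complete geodesics of $\mathbb H^2$). 2. If $\zeta(\mathbb H^2)\not\subseteq V_1$, then any two distinct hyperbolic lines $\ell_1\ne\ell_2$ contained in $\zeta^{-1}(V_1)$ satisfy $$d_{\mathbb H^2}(\ell_1,\ell_2) > \tfrac12\log A_1 - C .$$ -/

import Mathlib

open scoped Matrix

noncomputable section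

namespace HybridLattice

/-- The Lorentzian quadratic form `x₁² - x₂² - x₃² - x₄²` on row vectors. -/
def Q (w : Fin 4 → ℝ) : ℝ := w 0 ^ 2 - w 1 ^ 2 - w 2 ^ 2 - w 3 ^ 2

/-- The polar bilinear form of `Q`. -/
def B (v w : Fin 4 → ℝ) : ℝ := v 0 * w 0 - v 1 * w 1 - v 2 * w 2 - v 3 * w 3

/-- The quadratic form `7 x₁² - x₂² - x₃² - A x₄²`. -/
def QA (A : ℕ) (w : Fin 4 → ℝ) : ℝ :=
  7 * w 0 ^ 2 - w 1 ^ 2 - w 2 ^ 2 - (A : ℝ) * w 3 ^ 2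

/-- Hyperbolic 3-space, the upper sheet of the hyperboloid `Q = 1`. -/
def H3 : Type := {w : Fin 4 → ℝ // Q w = 1 ∧ 0 < w 0}

/-- The hyperbolic distance: `cosh (d(p, q)) = B(p, q)`. -/
def H3.hdist (p q : H3) : ℝ := Real.arcosh (B p.1 q.1)

/-- Hyperbolic plane, as the totally geodesic plane `x₄ = 0` of hyperbolic 3-space. -/
def H2 : Type := {p : H3 // p.1 3 = 0}

/-- The hyperbolic distance of the hyperbolic plane (the restriction of that of `H3`). -/
def H2.hdist (p q : H2) : ℝ := H3.hdist p.1 q.1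

/-- The distance between two sets, the infimum of the distances of their points. -/
def setDist {X : Type} (d : X → X → ℝ) (S T : Set X) : ℝ := sInf (Set.image2 d S T)

/-- A hyperbolic line: the image of an isometric embedding of the real line. -/
def H2.IsLine (l : Set H2) : Prop :=
  ∃ c : ℝ → H2, (∀ s t : ℝ, H2.hdist (c s) (c t) = |s - t|) ∧ Set.range c = l

/-- `{g ∈ SL₄(ℝ) : Q(w.g) = Q(w) for all w}`. -/
def SO31 : Subgroup (Matrix.SpecialLinearGroup (Fin 4) ℝ) where
  carrier := {g | ∀ w : Fin 4 → ℝ, Q (w ᵥ* (g : Matrix (Fin 4) (Fin 4) ℝ)) = Q w}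
  one_mem' := by intro w; simp
  mul_mem' := by
    intro a b ha hb w
    rw [Matrix.SpecialLinearGroup.coe_mul, ← Matrix.vecMul_vecMul, hb, ha]
  inv_mem' := by
    intro a ha w
    have h := ha (w ᵥ* ((a⁻¹ : Matrix.SpecialLinearGroup (Fin 4) ℝ) : Matrix (Fin 4) (Fin 4) ℝ))
    rw [Matrix.vecMul_vecMul, ← Matrix.SpecialLinearGroup.coe_mul] at h
    simpa using h.symm

/-- `G = SO(3,1)⁰`, the identity component of `SO31`. -/
def G : Subgroup (Matrix.SpecialLinearGroup (Fin 4) ℝ) :=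
  (Subgroup.connectedComponentOfOne SO31).map SO31.subtype

/-- The real matrix of an integral one. -/
def toReal : Matrix.SpecialLinearGroup (Fin 4) ℤ →* Matrix.SpecialLinearGroup (Fin 4) ℝ :=
  Matrix.SpecialLinearGroup.map (Int.castRingHom ℝ)

/-- `SO(Q_A, ℤ)`: the integral matrices of determinant one that preserve `Q_A`. -/
def SOZ (A : ℕ) : Subgroup (Matrix.SpecialLinearGroup (Fin 4) ℤ) where
  carrier := {γ | ∀ w : Fin 4 → ℝ,
    QA A (w ᵥ* (toReal γ : Matrix (Fin 4) (Fin 4) ℝ)) = QA A w}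
  one_mem' := by intro w; simp
  mul_mem' := by
    intro a b ha hb w
    rw [map_mul, Matrix.SpecialLinearGroup.coe_mul, ← Matrix.vecMul_vecMul, hb, ha]
  inv_mem' := by
    intro a ha w
    have h := ha (w ᵥ* (toReal a⁻¹ : Matrix (Fin 4) (Fin 4) ℝ))
    rw [Matrix.vecMul_vecMul, ← Matrix.SpecialLinearGroup.coe_mul, ← map_mul] at h
    simpa using h.symm

/-- The principal congruence subgroup `Γ(7) = ker (SL₄(ℤ) → SL₄(ℤ/7))`. -/
def Gamma7 : Subgroup (Matrix.SpecialLinearGroup (Fin 4) ℤ) :=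
  (Matrix.SpecialLinearGroup.map (n := Fin 4) (Int.castRingHom (ZMod 7))).ker

/-- The matrix `g_A = diag(√7, 1, 1, √A)`, for which `Q(w.g_A) = Q_A(w)`. -/
def gA (A : ℕ) : Matrix (Fin 4) (Fin 4) ℝ := Matrix.diagonal ![√7, 1, 1, √(A : ℝ)]

/-- The arithmetic lattice `g_A⁻¹ (SO(Q_A, ℤ) ∩ Γ(7)) g_A` in `G`. The equation `h = g_A⁻¹ γ g_A`
is written without the inverse; for `A > 0` the matrix `g_A` is invertible. -/
def Gam (A : ℕ) : Subgroup (Matrix.SpecialLinearGroup (Fin 4) ℝ) where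
  carrier := {h | h ∈ G ∧ ∃ γ ∈ SOZ A ⊓ Gamma7,
    gA A * (h : Matrix (Fin 4) (Fin 4) ℝ) = (toReal γ : Matrix (Fin 4) (Fin 4) ℝ) * gA A}
  one_mem' := ⟨one_mem _, 1, one_mem _, by simp⟩
  mul_mem' := by
    rintro a b ⟨ha, γ, hγ, h⟩ ⟨hb, γ', hγ', h'⟩
    refine ⟨mul_mem ha hb, γ * γ', mul_mem hγ hγ', ?_⟩
    rw [map_mul, Matrix.SpecialLinearGroup.coe_mul, Matrix.SpecialLinearGroup.coe_mul,
      ← Matrix.mul_assoc, h, Matrix.mul_assoc, h', Matrix.mul_assoc]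
  inv_mem' := by
    rintro a ⟨ha, γ, hγ, h⟩
    refine ⟨inv_mem ha, γ⁻¹, inv_mem hγ, ?_⟩
    have h1 : (a : Matrix (Fin 4) (Fin 4) ℝ) *
        ((a⁻¹ : Matrix.SpecialLinearGroup (Fin 4) ℝ) : Matrix (Fin 4) (Fin 4) ℝ) = 1 := by
      rw [← Matrix.SpecialLinearGroup.coe_mul]; simp
    have h2 : (toReal γ⁻¹ : Matrix (Fin 4) (Fin 4) ℝ) *
        (toReal γ : Matrix (Fin 4) (Fin 4) ℝ) = 1 := by
      rw [← Matrix.SpecialLinearGroup.coe_mul, ← map_mul]; simp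
    calc gA A * ((a⁻¹ : Matrix.SpecialLinearGroup (Fin 4) ℝ) : Matrix (Fin 4) (Fin 4) ℝ)
        = (toReal γ⁻¹ : Matrix (Fin 4) (Fin 4) ℝ) * ((toReal γ : Matrix (Fin 4) (Fin 4) ℝ) * gA A)
          * ((a⁻¹ : Matrix.SpecialLinearGroup (Fin 4) ℝ) : Matrix (Fin 4) (Fin 4) ℝ) := by
          rw [← Matrix.mul_assoc, h2, Matrix.one_mul]
      _ = _ := by rw [← h, Matrix.mul_assoc, Matrix.mul_assoc, h1, Matrix.mul_one]

/-- Two points of hyperbolic 3-space are equivalent when an element of the lattice, acting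
from the right on row vectors, moves one to the other. -/
def orbitSetoid (A : ℕ) : Setoid H3 where
  r p q := ∃ h ∈ Gam A, q.1 = p.1 ᵥ* (h : Matrix (Fin 4) (Fin 4) ℝ)
  iseqv := by
    refine ⟨fun p => ⟨1, one_mem _, by simp⟩, ?_, ?_⟩
    · rintro p q ⟨h, hh, e⟩
      refine ⟨h⁻¹, inv_mem hh, ?_⟩
      rw [e, Matrix.vecMul_vecMul, ← Matrix.SpecialLinearGroup.coe_mul]
      simp
    · rintro p q r ⟨h, hh, e⟩ ⟨h', hh', e'⟩
      refine ⟨h * h', mul_mem hh hh', ?_⟩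
      rw [e', e, Matrix.vecMul_vecMul, ← Matrix.SpecialLinearGroup.coe_mul]

/-- The arithmetic hyperbolic 3-manifold, the quotient of `H3` by the lattice. -/
def M (A : ℕ) : Type := Quotient (orbitSetoid A)

/-- The projection from hyperbolic 3-space onto the manifold. -/
def rho (A : ℕ) (p : H3) : M A := Quotient.mk (orbitSetoid A) p

/-- The distance on the manifold: the distance between the two orbits in `H3`. -/
def M.dist {A : ℕ} (x y : M A) : ℝ := setDist H3.hdist (rho A ⁻¹' {x}) (rho A ⁻¹' {y})

/-- The totally geodesic surface in the manifold, the image of the hyperbolic plane `x₄ = 0`. -/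
def V (A : ℕ) : Set (M A) := rho A '' {p : H3 | p.1 3 = 0}

/-- A locally isometric immersion of the hyperbolic plane: every point is the centre of a ball
on which the map preserves distances. -/
def IsLocallyIsometric {A : ℕ} (ζ : H2 → M A) : Prop :=
  ∀ x : H2, ∃ ε > 0, ∀ y z : H2, H2.hdist x y < ε → H2.hdist x z < ε →
    M.dist (ζ y) (ζ z) = H2.hdist y z

end HybridLattice

end

noncomputable section

namespace HybridLattice

open Filter Topology

/-! The lattice acts freely: an element fixing a point of `H3` has integral trace in [-2, 4]
congruent to 4 modulo 7, which forces it to be trivial (`eq_one_of_fixed`). Only finitely many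
elements have bounded size, so `rho` is isometric on small balls, and a local isometry ζ lifts near
each point to the restriction of a linear map L. Two linear lifts that agree modulo the lattice near
one point agree modulo it everywhere, so by connectedness a single L serves for the whole plane
(`exists_lift`).

The preimage of the surface is then the union, over h in the lattice, of the zero sets on `H2` of
the linear functionals `height L h`. Each is empty, a line or the whole plane, whence part 1. For
part 2, a line is uncountable and the lattice is countable, so one functional vanishes on the whole
of a line in the preimage (`exists_height_eq_zero_of_line`). Two lines thus give h₁ and h₂, and k =
h₁⁻¹h₂ compares the two corresponding lifts of the surface.

The arithmetic is in `last_column`. If (a, b, c, d) is the last column of the integral matrix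
conjugate to k, then A(a² - 7(b² + c²)) = 7(d² - 1) and d ≡ 1 mod 7. If d² = 1, anisotropy of the
form on the left gives a = b = c = 0; the two functionals are then proportional and the lines
coincide. Otherwise d² ≥ A/7 + 1, and the two planes are at distance at least arcosh |d|
(`abs_le_B_of_planes`), hence at least ½ log(A/7). -/

/-! ### Inequalities in Lorentzian signature -/

lemma B_self (v : Fin 4 → ℝ) : B v v = Q v := by simp only [B, Q]; ring

lemma B_comm (v w : Fin 4 → ℝ) : B v w = B w v := by simp only [B]; ring

lemma B_add_left (u v w : Fin 4 → ℝ) : B (u + v) w = B u w + B v w := by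
  simp only [B, Pi.add_apply]; ring

lemma B_sub_left (u v w : Fin 4 → ℝ) : B (u - v) w = B u w - B v w := by
  simp only [B, Pi.sub_apply]; ring

lemma B_smul_left (a : ℝ) (v w : Fin 4 → ℝ) : B (a • v) w = a * B v w := by
  simp only [B, Pi.smul_apply, smul_eq_mul]; ring

lemma B_add_right (u v w : Fin 4 → ℝ) : B u (v + w) = B u v + B u w := by
  simp only [B, Pi.add_apply]; ring

lemma B_sub_right (u v w : Fin 4 → ℝ) : B u (v - w) = B u v - B u w := by
  simp only [B, Pi.sub_apply]; ring

lemma B_smul_right (a : ℝ) (v w : Fin 4 → ℝ) : B v (a • w) = a * B v w := by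
  simp only [B, Pi.smul_apply, smul_eq_mul]; ring

lemma Q_smul_sub_smul (a b : ℝ) (u v : Fin 4 → ℝ) :
    Q (a • u - b • v) = a ^ 2 * Q u - 2 * a * b * B u v + b ^ 2 * Q v := by
  simp only [B, Q, Pi.sub_apply, Pi.smul_apply, smul_eq_mul]; ring

lemma Q_sub_smul (b : ℝ) (u v : Fin 4 → ℝ) :
    Q (u - b • v) = Q u - 2 * b * B u v + b ^ 2 * Q v := by
  simp only [B, Q, Pi.sub_apply, Pi.smul_apply, smul_eq_mul]; ring

lemma Q_sub (u v : Fin 4 → ℝ) : Q (u - v) = Q u - 2 * B u v + Q v := by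
  simp only [B, Q, Pi.sub_apply]; ring

/-- The orthogonal complement of a timelike vector is negative definite, quantitatively. -/
lemma sq_mul_Q_le {p u : Fin 4 → ℝ} (h : B p u = 0) :
    p 0 ^ 2 * Q u ≤ -(Q p * (u 1 ^ 2 + u 2 ^ 2 + u 3 ^ 2)) := by
  simp only [B, Q] at *
  have h1 : p 0 * u 0 = p 1 * u 1 + p 2 * u 2 + p 3 * u 3 := by linarith
  have h2 : p 0 ^ 2 * u 0 ^ 2 = (p 1 * u 1 + p 2 * u 2 + p 3 * u 3) ^ 2 := by rw [← h1]; ring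
  -- Lagrange's identity: these squares are the defect in Cauchy-Schwarz for the spatial parts.
  nlinarith [sq_nonneg (p 1 * u 2 - p 2 * u 1), sq_nonneg (p 1 * u 3 - p 3 * u 1),
    sq_nonneg (p 2 * u 3 - p 3 * u 2)]

lemma sq_pos_of_Q_pos {p : Fin 4 → ℝ} (hp : 0 < Q p) : 0 < p 0 ^ 2 := by
  simp only [Q] at hp
  nlinarith [sq_nonneg (p 1), sq_nonneg (p 2), sq_nonneg (p 3)]

lemma Q_nonpos_of_orthogonal {p u : Fin 4 → ℝ} (hp : 0 < Q p) (h : B p u = 0) : Q u ≤ 0 := by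
  have h1 := sq_mul_Q_le h
  have h2 := sq_pos_of_Q_pos hp
  have h3 : 0 ≤ Q p * (u 1 ^ 2 + u 2 ^ 2 + u 3 ^ 2) := by positivity
  by_contra! h4
  nlinarith

lemma eq_zero_of_orthogonal {p u : Fin 4 → ℝ} (hp : 0 < Q p) (h : B p u = 0) (hu : Q u = 0) :
    u = 0 := by
  have h1 := sq_mul_Q_le h
  rw [hu, mul_zero] at h1
  have h4 : u 1 ^ 2 + u 2 ^ 2 + u 3 ^ 2 ≤ 0 := by
    by_contra! h4
    nlinarith [mul_pos hp h4]
  have e1 : u 1 = 0 := by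
    nlinarith [sq_nonneg (u 1), sq_nonneg (u 2), sq_nonneg (u 3)]
  have e2 : u 2 = 0 := by
    nlinarith [sq_nonneg (u 1), sq_nonneg (u 2), sq_nonneg (u 3)]
  have e3 : u 3 = 0 := by
    nlinarith [sq_nonneg (u 1), sq_nonneg (u 2), sq_nonneg (u 3)]
  have e0 : u 0 = 0 := by
    simp only [Q, e1, e2, e3] at hu
    nlinarith
  ext i
  fin_cases i <;> simpa

/-- The reverse Cauchy-Schwarz inequality. -/
lemma Q_mul_Q_le_sq {p v : Fin 4 → ℝ} (hp : 0 < Q p) : Q p * Q v ≤ B p v ^ 2 := by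
  -- The component of v orthogonal to p, scaled by `Q p` to avoid a division.
  have h : B p (Q p • v - B p v • p) = 0 := by
    rw [B_sub_right, B_smul_right, B_smul_right, B_self]; ring
  have h1 := Q_nonpos_of_orthogonal hp h
  have h2 : Q (Q p • v - B p v • p) = Q p * (Q p * Q v - B p v ^ 2) := by
    rw [Q_smul_sub_smul, B_comm v p]; ring
  rw [h2] at h1
  nlinarith [nonpos_of_mul_nonpos_right h1 hp]

/-- The Cauchy-Schwarz inequality on the orthogonal complement of a timelike vector. -/
lemma sq_le_Q_mul_Q {p u v : Fin 4 → ℝ} (hp : 0 < Q p) (hu : B p u = 0) (hv : B p v = 0) :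
    B u v ^ 2 ≤ Q u * Q v := by
  rcases (Q_nonpos_of_orthogonal hp hv).lt_or_eq with h0 | h0
  · have h : B p (Q v • u - B u v • v) = 0 := by
      rw [B_sub_right, B_smul_right, B_smul_right, hu, hv]; ring
    have h1 := Q_nonpos_of_orthogonal hp h
    have h2 : Q (Q v • u - B u v • v) = Q v * (Q u * Q v - B u v ^ 2) := by
      rw [Q_smul_sub_smul]; ring
    rw [h2] at h1
    by_contra! h3
    nlinarith [mul_pos_of_neg_of_neg h0 (sub_neg.mpr h3)]
  · rw [eq_zero_of_orthogonal hp hv h0]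
    simp [B, Q]

/-! ### The hyperboloid and its metric -/

/-- The condition on a vector to lie in hyperbolic 3-space. -/
def OnH3 (p : Fin 4 → ℝ) : Prop := Q p = 1 ∧ 0 < p 0

lemma OnH3.Q_pos {p : Fin 4 → ℝ} (hp : OnH3 p) : 0 < Q p := by rw [hp.1]; exact one_pos

/-- Reverse Cauchy-Schwarz gives only B² ≥ 1; the sign comes from ordinary Cauchy-Schwarz on the
spatial parts, since both points lie on the upper sheet. -/
lemma OnH3.one_le_B {p q : Fin 4 → ℝ} (hp : OnH3 p) (hq : OnH3 q) : 1 ≤ B p q := by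
  have h := Q_mul_Q_le_sq (v := q) hp.Q_pos
  rw [hp.1, hq.1] at h
  have hpos : 0 < B p q := by
    have h1 := hp.1
    have h2 := hq.1
    have hp0 := hp.2
    have hq0 := hq.2
    by_contra! h3
    simp only [B, Q] at *
    have h4 : (p 0 * q 0) ^ 2 ≤ (p 1 * q 1 + p 2 * q 2 + p 3 * q 3) ^ 2 := by
      apply pow_le_pow_left₀ (by positivity); linarith
    have h5 : (p 1 * q 1 + p 2 * q 2 + p 3 * q 3) ^ 2 ≤
        (p 1 ^ 2 + p 2 ^ 2 + p 3 ^ 2) * (q 1 ^ 2 + q 2 ^ 2 + q 3 ^ 2) := by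
      nlinarith [sq_nonneg (p 1 * q 2 - p 2 * q 1), sq_nonneg (p 1 * q 3 - p 3 * q 1),
        sq_nonneg (p 2 * q 3 - p 3 * q 2)]
    have h6 : p 1 ^ 2 + p 2 ^ 2 + p 3 ^ 2 = p 0 ^ 2 - 1 := by linarith
    have h7 : q 1 ^ 2 + q 2 ^ 2 + q 3 ^ 2 = q 0 ^ 2 - 1 := by linarith
    rw [h6, h7] at h5
    have h8 : 0 ≤ p 0 ^ 2 - 1 := by rw [← h6]; positivity
    have h9 : 0 ≤ q 0 ^ 2 - 1 := by rw [← h7]; positivity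
    nlinarith
  nlinarith

lemma OnH3.eq_of_B_eq_one {p q : Fin 4 → ℝ} (hp : OnH3 p) (hq : OnH3 q) (h : B p q = 1) :
    q = p := by
  have h1 : B p (q - p) = 0 := by rw [B_sub_right, B_self, h, hp.1, sub_self]
  have h2 : Q (q - p) = 0 := by
    rw [Q_sub, B_comm q p, h, hp.1, hq.1]; ring
  exact sub_eq_zero.mp (eq_zero_of_orthogonal hp.Q_pos h1 h2)

lemma OnH3.of_B_pos {p q : Fin 4 → ℝ} (hp : OnH3 p) (hq : Q q = 1) (h : 0 < B p q) :
    OnH3 q := by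
  refine ⟨hq, ?_⟩
  by_contra! h0
  have h1 : 0 < q 0 ^ 2 := sq_pos_of_Q_pos (by rw [hq]; exact one_pos)
  have h2 : OnH3 (-q) := by
    refine ⟨by rw [← hq]; simp [Q], ?_⟩
    rcases h0.lt_or_eq with h0 | h0
    · simpa using h0
    · simp [h0] at h1
  have h3 := hp.one_le_B h2
  have h4 : B p (-q) = -B p q := by simp only [B, Pi.neg_apply]; ring
  linarith

/-- Split p and r into their components along q and orthogonal to q. Cauchy-Schwarz for the
orthogonal components is the addition formula for cosh turned into an inequality. -/
lemma arcosh_triangle {p q r : Fin 4 → ℝ} (hp : OnH3 p) (hq : OnH3 q) (hr : OnH3 r) :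
    Real.arcosh (B p r) ≤ Real.arcosh (B p q) + Real.arcosh (B q r) := by
  have ha := hp.one_le_B hq
  have hb := hq.one_le_B hr
  have hc := hp.one_le_B hr
  have hs : 0 ≤ Real.arcosh (B p q) + Real.arcosh (B q r) :=
    add_nonneg (Real.arcosh_nonneg ha) (Real.arcosh_nonneg hb)
  rw [← Real.arcosh_cosh hs, Real.arcosh_le_arcosh (by linarith) (Real.cosh_pos _),
    Real.cosh_add, Real.cosh_arcosh ha, Real.cosh_arcosh hb, Real.sinh_arcosh ha,
    Real.sinh_arcosh hb, ← Real.sqrt_mul (by nlinarith)]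
  have hu : B q (p - B p q • q) = 0 := by
    rw [B_sub_right, B_smul_right, B_self, hq.1, B_comm q p]; ring
  have hv : B q (r - B q r • q) = 0 := by
    rw [B_sub_right, B_smul_right, B_self, hq.1]; ring
  have h := sq_le_Q_mul_Q hq.Q_pos hu hv
  have e : B (p - B p q • q) (r - B q r • q) = B p r - B p q * B q r := by
    simp only [B_sub_right, B_smul_right, B_sub_left, B_smul_left, B_self, hq.1]; ring
  have e1 : Q (p - B p q • q) = 1 - B p q ^ 2 := by
    rw [Q_sub_smul, hq.1, hp.1]; ring
  have e2 : Q (r - B q r • q) = 1 - B q r ^ 2 := by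
    rw [Q_sub_smul, hq.1, hr.1, B_comm r q]; ring
  rw [e, e1, e2] at h
  have := Real.le_sqrt_of_sq_le (h.trans_eq (by ring : _ = (B p q ^ 2 - 1) * (B q r ^ 2 - 1)))
  linarith

lemma H3.onH3 (p : H3) : OnH3 p.1 := p.2

lemma H3.hdist_nonneg (p q : H3) : 0 ≤ H3.hdist p q :=
  Real.arcosh_nonneg (p.onH3.one_le_B q.onH3)

lemma H3.hdist_comm (p q : H3) : H3.hdist p q = H3.hdist q p := by
  rw [H3.hdist, H3.hdist, B_comm]

lemma H3.hdist_triangle (p q r : H3) : H3.hdist p r ≤ H3.hdist p q + H3.hdist q r :=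
  arcosh_triangle p.onH3 q.onH3 r.onH3

lemma H3.cosh_hdist (p q : H3) : Real.cosh (H3.hdist p q) = B p.1 q.1 :=
  Real.cosh_arcosh (p.onH3.one_le_B q.onH3)

lemma H3.hdist_lt_iff (p q : H3) {r : ℝ} (hr : 0 < r) :
    H3.hdist p q < r ↔ B p.1 q.1 < Real.cosh r := by
  rw [← H3.cosh_hdist, Real.cosh_lt_cosh, abs_of_nonneg (H3.hdist_nonneg p q), abs_of_pos hr]

lemma H3.hdist_eq_iff {p q p' q' : H3} :
    H3.hdist p q = H3.hdist p' q' ↔ B p.1 q.1 = B p'.1 q'.1 :=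
  ⟨fun h => by rw [← H3.cosh_hdist, h, H3.cosh_hdist], fun h => by rw [H3.hdist, h, H3.hdist]⟩

lemma H3.eq_of_hdist_eq_zero {p q : H3} (h : H3.hdist p q = 0) : q = p := by
  apply Subtype.ext
  apply p.onH3.eq_of_B_eq_one q.onH3
  rw [← H3.cosh_hdist, h, Real.cosh_zero]

/-! ### Orthonormal bases and the Lorentz group -/

/-- The Gram matrix of `Q`. -/
def eta : Matrix (Fin 4) (Fin 4) ℝ := Matrix.diagonal ![1, -1, -1, -1]

/-- The boost that takes the base point of hyperbolic 3-space to `p`. -/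
def boost (p : Fin 4 → ℝ) : Matrix (Fin 4) (Fin 4) ℝ :=
  !![p 0, p 1, p 2, p 3;
     p 1, 1 + p 1 * p 1 * (1 + p 0)⁻¹, p 1 * p 2 * (1 + p 0)⁻¹, p 1 * p 3 * (1 + p 0)⁻¹;
     p 2, p 2 * p 1 * (1 + p 0)⁻¹, 1 + p 2 * p 2 * (1 + p 0)⁻¹, p 2 * p 3 * (1 + p 0)⁻¹;
     p 3, p 3 * p 1 * (1 + p 0)⁻¹, p 3 * p 2 * (1 + p 0)⁻¹, 1 + p 3 * p 3 * (1 + p 0)⁻¹]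

lemma boost_zero (p : Fin 4 → ℝ) : boost p 0 = p := by
  ext j; fin_cases j <;> rfl

lemma mul_eta_mul_transpose_apply (a b : Matrix (Fin 4) (Fin 4) ℝ) (i j : Fin 4) :
    (a * eta * bᵀ) i j = B (a i) (b j) := by
  simp [Matrix.mul_apply, eta, Fin.sum_univ_four, B, Matrix.diagonal_apply, sub_eq_add_neg]

lemma boost_mul_eta {p : Fin 4 → ℝ} (hp : OnH3 p) : boost p * eta * (boost p)ᵀ = eta := by
  have h0 : 1 + p 0 ≠ 0 := by linarith [hp.2]
  have hs : (1 + p 0)⁻¹ * (1 + p 0) = 1 := inv_mul_cancel₀ h0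
  have hq := hp.1
  simp only [Q] at hq
  ext i j
  rw [mul_eta_mul_transpose_apply]
  simp only [B, eta, boost, Matrix.diagonal_apply]
  -- With s a variable subject to s(1 + p 0) = 1, every entry is a polynomial identity modulo `hs`
  -- and `hq`.
  generalize (1 + p 0)⁻¹ = s at hs
  fin_cases i <;> fin_cases j <;> simp <;> grind

lemma eta_mul_eta : eta * eta = 1 := by
  rw [eta, Matrix.diagonal_mul_diagonal, ← Matrix.diagonal_one]
  congr 1
  ext i
  fin_cases i <;> simp

/-- The expansion of a vector in a Lorentz orthonormal basis. -/
lemma expand_of_mul_eta {F : Matrix (Fin 4) (Fin 4) ℝ} (hF : F * eta * Fᵀ = eta)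
    (w : Fin 4 → ℝ) :
    w = B w (F 0) • F 0 - B w (F 1) • F 1 - B w (F 2) • F 2 - B w (F 3) • F 3 := by
  have h1 : F * (eta * Fᵀ * eta) = 1 := by
    rw [← Matrix.mul_assoc, ← Matrix.mul_assoc, hF, eta_mul_eta]
  have h2 : eta * Fᵀ * eta * F = 1 := mul_eq_one_comm.mp h1
  have h3 : w ᵥ* (eta * Fᵀ * eta) ᵥ* F = w := by
    rw [Matrix.vecMul_vecMul, h2, Matrix.vecMul_one]
  have h4 : ∀ i, (w ᵥ* (eta * Fᵀ)) i = B w (F i) := by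
    intro i
    simp [Matrix.vecMul, dotProduct, Matrix.mul_apply, eta, Fin.sum_univ_four, B,
      Matrix.diagonal_apply, sub_eq_add_neg]
  conv_lhs => rw [← h3, ← Matrix.vecMul_vecMul]
  ext j
  have h5 : ∀ i, (w ᵥ* (eta * Fᵀ) ᵥ* eta) i = B w (F i) * ![1, -1, -1, -1] i := by
    intro i
    rw [← h4, eta, Matrix.vecMul_diagonal]
  rw [Matrix.vecMul, dotProduct, Fin.sum_univ_four]
  simp only [h5]
  simp
  ring

lemma B_vecMul {h : Matrix.SpecialLinearGroup (Fin 4) ℝ} (hh : h ∈ SO31) (v w : Fin 4 → ℝ) :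
    B (v ᵥ* (h : Matrix (Fin 4) (Fin 4) ℝ)) (w ᵥ* (h : Matrix (Fin 4) (Fin 4) ℝ)) = B v w := by
  have polar : ∀ x y, B x y = (Q (x + y) - Q x - Q y) / 2 := by
    intro x y; simp only [B, Q, Pi.add_apply]; ring
  have hQ : ∀ x, Q (x ᵥ* (h : Matrix (Fin 4) (Fin 4) ℝ)) = Q x := hh
  rw [polar, polar, ← Matrix.add_vecMul, hQ, hQ, hQ]

lemma row_eq_vecMul (a b : Matrix (Fin 4) (Fin 4) ℝ) (i : Fin 4) : (a * b) i = a i ᵥ* b := rfl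

lemma B_row {h : Matrix.SpecialLinearGroup (Fin 4) ℝ} (hh : h ∈ SO31) (i j : Fin 4) :
    B ((h : Matrix (Fin 4) (Fin 4) ℝ) i) ((h : Matrix (Fin 4) (Fin 4) ℝ) j) = eta i j := by
  have e : ∀ i, (h : Matrix (Fin 4) (Fin 4) ℝ) i =
      (1 : Matrix (Fin 4) (Fin 4) ℝ) i ᵥ* (h : Matrix (Fin 4) (Fin 4) ℝ) := by
    intro i; rw [← row_eq_vecMul, one_mul]
  rw [e i, e j, B_vecMul hh, ← mul_eta_mul_transpose_apply]
  simp

lemma mul_eta_mul_transpose {h : Matrix.SpecialLinearGroup (Fin 4) ℝ} (hh : h ∈ SO31) :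
    (h : Matrix (Fin 4) (Fin 4) ℝ) * eta * (h : Matrix (Fin 4) (Fin 4) ℝ)ᵀ = eta := by
  ext i j
  rw [mul_eta_mul_transpose_apply, B_row hh]

lemma transpose_mul_eta_mul {h : Matrix.SpecialLinearGroup (Fin 4) ℝ} (hh : h ∈ SO31) :
    (h : Matrix (Fin 4) (Fin 4) ℝ)ᵀ * eta * (h : Matrix (Fin 4) (Fin 4) ℝ) = eta := by
  have h1 : (h : Matrix (Fin 4) (Fin 4) ℝ) * (eta * (h : Matrix (Fin 4) (Fin 4) ℝ)ᵀ * eta) = 1 := by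
    rw [← Matrix.mul_assoc, ← Matrix.mul_assoc, mul_eta_mul_transpose hh, eta_mul_eta]
  have h2 := mul_eq_one_comm.mp h1
  calc _ = eta * (eta * (h : Matrix (Fin 4) (Fin 4) ℝ)ᵀ * eta * (h : Matrix (Fin 4) (Fin 4) ℝ)) := by
        simp only [← Matrix.mul_assoc, eta_mul_eta, Matrix.one_mul]
    _ = eta := by rw [h2, Matrix.mul_one]

lemma G_le_SO31 : G ≤ SO31 := by
  rintro _ ⟨g, -, rfl⟩
  exact g.2

lemma one_le_sq_entry {h : Matrix.SpecialLinearGroup (Fin 4) ℝ} (hh : h ∈ SO31) :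
    1 ≤ (h : Matrix (Fin 4) (Fin 4) ℝ) 0 0 ^ 2 := by
  have h1 := B_row hh 0 0
  simp only [B, eta, Matrix.diagonal_apply_eq, Matrix.cons_val_zero] at h1
  nlinarith [sq_nonneg ((h : Matrix (Fin 4) (Fin 4) ℝ) 0 1),
    sq_nonneg ((h : Matrix (Fin 4) (Fin 4) ℝ) 0 2), sq_nonneg ((h : Matrix (Fin 4) (Fin 4) ℝ) 0 3)]

/-- The identity component preserves the sheets of the hyperboloid. -/
lemma entry_pos {h : Matrix.SpecialLinearGroup (Fin 4) ℝ} (hh : h ∈ G) :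
    0 < (h : Matrix (Fin 4) (Fin 4) ℝ) 0 0 := by
  obtain ⟨g, hg, rfl⟩ := hh
  have hc : Continuous fun g : SO31 =>
      ((g : Matrix.SpecialLinearGroup (Fin 4) ℝ) : Matrix (Fin 4) (Fin 4) ℝ) 0 0 :=
    (Continuous.matrix_elem (A := fun g : SO31 =>
      ((g : Matrix.SpecialLinearGroup (Fin 4) ℝ) : Matrix (Fin 4) (Fin 4) ℝ))
      (Continuous.comp (g := fun g : Matrix.SpecialLinearGroup (Fin 4) ℝ =>
        (g : Matrix (Fin 4) (Fin 4) ℝ)) continuous_subtype_val continuous_subtype_val) 0 0)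
  -- Otherwise the entry, equal to 1 at the identity, would vanish somewhere on the connected
  -- component, where its square is at least 1.
  by_contra! h0
  have h1 : (1 : SO31) ∈ connectedComponent (1 : SO31) := mem_connectedComponent
  obtain ⟨k, -, hk⟩ := isPreconnected_connectedComponent.intermediate_value hg h1
    hc.continuousOn ⟨h0, by simp⟩
  have h2 := one_le_sq_entry k.2
  simp only at hk
  rw [hk] at h2
  norm_num at h2

lemma onH3_row {h : Matrix.SpecialLinearGroup (Fin 4) ℝ} (hh : h ∈ G) :
    OnH3 ((h : Matrix (Fin 4) (Fin 4) ℝ) 0) :=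
  ⟨by rw [← B_self, B_row (G_le_SO31 hh)]; simp [eta], entry_pos hh⟩

lemma one_row : (1 : Matrix (Fin 4) (Fin 4) ℝ) 0 = ![1, 0, 0, 0] := by
  ext i; fin_cases i <;> rfl

lemma onH3_one_row : OnH3 ((1 : Matrix (Fin 4) (Fin 4) ℝ) 0) := by
  rw [one_row]; exact ⟨by simp [Q], by simp⟩

lemma OnH3.vecMul {h : Matrix.SpecialLinearGroup (Fin 4) ℝ} (hh : h ∈ G) {p : Fin 4 → ℝ}
    (hp : OnH3 p) : OnH3 (p ᵥ* (h : Matrix (Fin 4) (Fin 4) ℝ)) := by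
  refine (onH3_row hh).of_B_pos ((G_le_SO31 hh p).trans hp.1) ?_
  have e : (h : Matrix (Fin 4) (Fin 4) ℝ) 0 =
      (1 : Matrix (Fin 4) (Fin 4) ℝ) 0 ᵥ* (h : Matrix (Fin 4) (Fin 4) ℝ) := by
    rw [← row_eq_vecMul, one_mul]
  rw [e, B_vecMul (G_le_SO31 hh)]
  linarith [onH3_one_row.one_le_B hp]

/-! ### Freeness and proper discontinuity of the lattice action -/

lemma rho_eq_iff {A : ℕ} {p q : H3} :
    rho A p = rho A q ↔ ∃ h ∈ Gam A, q.1 = p.1 ᵥ* (h : Matrix (Fin 4) (Fin 4) ℝ) :=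
  Quotient.eq (r := orbitSetoid A)

lemma gA_pos {A : ℕ} (hA : 0 < A) (i : Fin 4) : 0 < ![√7, 1, 1, √(A : ℝ)] i := by
  have : (0 : ℝ) < A := by exact_mod_cast hA
  fin_cases i <;> simp [this]

lemma entry_rel {A : ℕ} {h : Matrix.SpecialLinearGroup (Fin 4) ℝ}
    {γ : Matrix.SpecialLinearGroup (Fin 4) ℤ}
    (e : gA A * (h : Matrix (Fin 4) (Fin 4) ℝ) = (toReal γ : Matrix (Fin 4) (Fin 4) ℝ) * gA A)
    (i j : Fin 4) :
    ![√7, 1, 1, √(A : ℝ)] i * (h : Matrix (Fin 4) (Fin 4) ℝ) i j =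
      ((γ : Matrix (Fin 4) (Fin 4) ℤ) i j : ℝ) * ![√7, 1, 1, √(A : ℝ)] j := by
  have h1 := congrFun (congrFun e i) j
  rw [gA, Matrix.diagonal_mul, Matrix.mul_diagonal] at h1
  exact h1

lemma entry_mod {γ : Matrix.SpecialLinearGroup (Fin 4) ℤ} (hγ : γ ∈ Gamma7) (i j : Fin 4) :
    (((γ : Matrix (Fin 4) (Fin 4) ℤ) i j : ℤ) : ZMod 7) = (1 : Matrix (Fin 4) (Fin 4) (ZMod 7)) i j := by
  have h1 : Matrix.SpecialLinearGroup.map (n := Fin 4) (Int.castRingHom (ZMod 7)) γ = 1 := hγ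
  have h2 := congrArg (fun m : Matrix.SpecialLinearGroup (Fin 4) (ZMod 7) =>
    (m : Matrix (Fin 4) (Fin 4) (ZMod 7)) i j) h1
  simpa using h2

lemma trace_eq_of_mul_eta {F : Matrix (Fin 4) (Fin 4) ℝ} (hF : F * eta * Fᵀ = eta)
    (h : Matrix (Fin 4) (Fin 4) ℝ) :
    h.trace = B (F 0 ᵥ* h) (F 0) - B (F 1 ᵥ* h) (F 1) - B (F 2 ᵥ* h) (F 2)
      - B (F 3 ᵥ* h) (F 3) := by
  have h1 : F * (eta * Fᵀ * eta) = 1 := by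
    rw [← Matrix.mul_assoc, ← Matrix.mul_assoc, hF, eta_mul_eta]
  have h2 : eta * Fᵀ * eta * F = 1 := mul_eq_one_comm.mp h1
  have h3 : h.trace = ((F * h) * eta * Fᵀ * eta).trace := by
    have : (F * h) * eta * Fᵀ * eta = F * (h * (eta * Fᵀ * eta)) := by
      simp only [Matrix.mul_assoc]
    rw [this, Matrix.trace_mul_comm, Matrix.mul_assoc, h2, Matrix.mul_one]
  rw [h3, Matrix.trace, Fin.sum_univ_four]
  have h4 : ∀ i, ((F * h) * eta * Fᵀ * eta) i i = B (F i ᵥ* h) (F i) * ![1, -1, -1, -1] i := by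
    intro i
    conv_lhs => rw [eta, Matrix.mul_diagonal, ← eta, mul_eta_mul_transpose_apply]
    rfl
  simp only [Matrix.diag_apply, h4]
  simp
  ring

/-- The lattice acts freely on hyperbolic 3-space. -/
lemma eq_one_of_fixed {A : ℕ} (hA : 0 < A) {h : Matrix.SpecialLinearGroup (Fin 4) ℝ}
    (hh : h ∈ Gam A) {p : Fin 4 → ℝ} (hp : OnH3 p)
    (hfix : p ᵥ* (h : Matrix (Fin 4) (Fin 4) ℝ) = p) : h = 1 := by
  obtain ⟨hG, γ, hγ, e⟩ := hh
  have hS := G_le_SO31 hG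
  set F := boost p with hFdef
  have hF : F * eta * Fᵀ = eta := boost_mul_eta hp
  have hF0 : F 0 = p := boost_zero p
  have hB : ∀ i j, B (F i) (F j) = eta i j := by
    intro i j; rw [← mul_eta_mul_transpose_apply, hF]
  have hdiag : ∀ i, (h : Matrix (Fin 4) (Fin 4) ℝ) i i =
      ((γ : Matrix (Fin 4) (Fin 4) ℤ) i i : ℝ) := by
    intro i
    have h1 := entry_rel e i i
    rw [mul_comm] at h1
    exact mul_right_cancel₀ (gA_pos hA i).ne' h1
  have htr := trace_eq_of_mul_eta hF (h : Matrix (Fin 4) (Fin 4) ℝ)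
  rw [Matrix.trace, Fin.sum_univ_four] at htr
  simp only [Matrix.diag_apply, hdiag, hF0, hfix, B_self, hp.1] at htr
  have horth : ∀ i, i ≠ 0 → B p (F i) = 0 := by
    intro i hi
    rw [← hF0, hB, eta, Matrix.diagonal_apply_ne _ hi.symm]
  have horth' : ∀ i, i ≠ 0 → B p (F i ᵥ* (h : Matrix (Fin 4) (Fin 4) ℝ)) = 0 := by
    intro i hi
    conv_lhs => rw [← hfix]
    rw [B_vecMul hS, horth i hi]
  have hQ : ∀ i, i ≠ 0 → Q (F i) = -1 := by
    intro i hi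
    rw [← B_self, hB, eta, Matrix.diagonal_apply_eq]
    fin_cases i <;> simp at hi ⊢
  have hQ' : ∀ i, i ≠ 0 → Q (F i ᵥ* (h : Matrix (Fin 4) (Fin 4) ℝ)) = -1 := by
    intro i hi
    rw [← hQ i hi]; exact hS (F i)
  -- h preserves the negative definite complement of p, so each of the other three diagonal terms of
  -- the trace is at most 1 in absolute value.
  have hle : ∀ i, i ≠ 0 → |B (F i ᵥ* (h : Matrix (Fin 4) (Fin 4) ℝ)) (F i)| ≤ 1 := by
    intro i hi
    have h1 := sq_le_Q_mul_Q hp.Q_pos (horth' i hi) (horth i hi)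
    rw [hQ i hi, hQ' i hi] at h1
    exact abs_le_one_iff_mul_self_le_one.mpr (by nlinarith)
  have l1 := abs_le.mp (hle 1 (by decide))
  have l2 := abs_le.mp (hle 2 (by decide))
  have l3 := abs_le.mp (hle 3 (by decide))
  -- The trace lies in [1 - 3, 1 + 3], which has length less than 7, and 4 is its only member
  -- congruent to 4 modulo 7. So all three terms are extremal.
  have hT : (γ : Matrix (Fin 4) (Fin 4) ℤ) 0 0 + (γ : Matrix (Fin 4) (Fin 4) ℤ) 1 1 +
      (γ : Matrix (Fin 4) (Fin 4) ℤ) 2 2 + (γ : Matrix (Fin 4) (Fin 4) ℤ) 3 3 = 4 := by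
    have hdvd : (7 : ℤ) ∣ (γ : Matrix (Fin 4) (Fin 4) ℤ) 0 0 + (γ : Matrix (Fin 4) (Fin 4) ℤ) 1 1 +
      (γ : Matrix (Fin 4) (Fin 4) ℤ) 2 2 + (γ : Matrix (Fin 4) (Fin 4) ℤ) 3 3 - 4 := by
      apply (ZMod.intCast_zmod_eq_zero_iff_dvd _ 7).mp
      push_cast
      simp only [entry_mod hγ.2, Matrix.one_apply_eq]
      decide
    have u : (γ : Matrix (Fin 4) (Fin 4) ℤ) 0 0 + (γ : Matrix (Fin 4) (Fin 4) ℤ) 1 1 +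
      (γ : Matrix (Fin 4) (Fin 4) ℤ) 2 2 + (γ : Matrix (Fin 4) (Fin 4) ℤ) 3 3 ≤ 4 := by
      exact_mod_cast (by linarith : ((γ : Matrix (Fin 4) (Fin 4) ℤ) 0 0 +
        (γ : Matrix (Fin 4) (Fin 4) ℤ) 1 1 + (γ : Matrix (Fin 4) (Fin 4) ℤ) 2 2 +
        (γ : Matrix (Fin 4) (Fin 4) ℤ) 3 3 : ℝ) ≤ 4)
    have l : -2 ≤ (γ : Matrix (Fin 4) (Fin 4) ℤ) 0 0 + (γ : Matrix (Fin 4) (Fin 4) ℤ) 1 1 +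
      (γ : Matrix (Fin 4) (Fin 4) ℤ) 2 2 + (γ : Matrix (Fin 4) (Fin 4) ℤ) 3 3 := by
      exact_mod_cast (by linarith : -2 ≤ ((γ : Matrix (Fin 4) (Fin 4) ℤ) 0 0 +
        (γ : Matrix (Fin 4) (Fin 4) ℤ) 1 1 + (γ : Matrix (Fin 4) (Fin 4) ℤ) 2 2 +
        (γ : Matrix (Fin 4) (Fin 4) ℤ) 3 3 : ℝ))
    omega
  have hT' : ((γ : Matrix (Fin 4) (Fin 4) ℤ) 0 0 + (γ : Matrix (Fin 4) (Fin 4) ℤ) 1 1 +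
      (γ : Matrix (Fin 4) (Fin 4) ℤ) 2 2 + (γ : Matrix (Fin 4) (Fin 4) ℤ) 3 3 : ℝ) = 4 := by
    exact_mod_cast hT
  rw [hT'] at htr
  -- Equality in Cauchy-Schwarz: the difference of the two vectors is orthogonal to p and null.
  have key : ∀ i, i ≠ 0 → B (F i ᵥ* (h : Matrix (Fin 4) (Fin 4) ℝ)) (F i) = -1 →
      F i ᵥ* (h : Matrix (Fin 4) (Fin 4) ℝ) = F i := by
    intro i hi hb
    apply sub_eq_zero.mp
    apply eq_zero_of_orthogonal hp.Q_pos
    · rw [B_sub_right, horth i hi, horth' i hi, sub_zero]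
    · rw [Q_sub, hQ i hi, hQ' i hi, hb]; norm_num
  have hFh : F * (h : Matrix (Fin 4) (Fin 4) ℝ) = F := by
    funext i
    rw [row_eq_vecMul]
    fin_cases i
    · change F 0 ᵥ* _ = F 0
      rw [hF0, hfix]
    · exact key 1 (by decide) (by linarith)
    · exact key 2 (by decide) (by linarith)
    · exact key 3 (by decide) (by linarith)
  have h1 : F * (eta * Fᵀ * eta) = 1 := by
    rw [← Matrix.mul_assoc, ← Matrix.mul_assoc, hF, eta_mul_eta]
  have h2 : eta * Fᵀ * eta * F = 1 := mul_eq_one_comm.mp h1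
  apply Subtype.ext
  calc (h : Matrix (Fin 4) (Fin 4) ℝ) = eta * Fᵀ * eta * (F * (h : Matrix (Fin 4) (Fin 4) ℝ)) := by
        rw [← Matrix.mul_assoc, h2, Matrix.one_mul]
    _ = _ := by rw [hFh, h2]; rfl

/-- Row 0 is a point of the hyperboloid, and every other row is a unit spacelike vector orthogonal
to it, so `sq_mul_Q_le` bounds its spatial part by the entry (0, 0). -/
lemma abs_entry_le {h : Matrix.SpecialLinearGroup (Fin 4) ℝ} (hh : h ∈ G) (i j : Fin 4) :
    |(h : Matrix (Fin 4) (Fin 4) ℝ) i j| ≤ (h : Matrix (Fin 4) (Fin 4) ℝ) 0 0 := by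
  have hS := G_le_SO31 hh
  set m := (h : Matrix (Fin 4) (Fin 4) ℝ) with hm
  have hpos : 0 < m 0 0 := entry_pos hh
  apply abs_le_of_sq_le_sq _ hpos.le
  have hn : ∀ k, 0 ≤ m i k ^ 2 := fun k => sq_nonneg _
  have hb : m i 1 ^ 2 + m i 2 ^ 2 + m i 3 ^ 2 ≤ m 0 0 ^ 2 ∧ m i 0 ^ 2 ≤ m 0 0 ^ 2 := by
    by_cases hi : i = 0
    · subst hi
      have h1 := (onH3_row hh).1
      simp only [Q, ← hm] at h1
      constructor <;> linarith
    · have h1 : B (m 0) (m i) = 0 := by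
        rw [hm, B_row hS, eta, Matrix.diagonal_apply_ne _ (Ne.symm hi)]
      have h2 : Q (m i) = -1 := by
        rw [← B_self, hm, B_row hS, eta, Matrix.diagonal_apply_eq]
        fin_cases i <;> simp at hi ⊢
      have h3 := sq_mul_Q_le h1
      rw [h2, show Q (m 0) = 1 from (onH3_row hh).1] at h3
      simp only [Q] at h2
      constructor <;> linarith
  have := hn 1
  have := hn 2
  have := hn 3
  fin_cases j <;> simp only [Fin.zero_eta, Fin.mk_one, Fin.reduceFinMk] <;> linarith

/-- The entry (0, 0) bounds all entries of h, hence those of the integral matrix γ conjugate to it,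
and γ determines h. -/
lemma finite_entry_le {A : ℕ} (hA : 0 < A) (K : ℝ) :
    {h | h ∈ Gam A ∧ (h : Matrix (Fin 4) (Fin 4) ℝ) 0 0 ≤ K}.Finite := by
  obtain ⟨N, hN⟩ := exists_nat_ge ((√7 + √(A : ℝ)) * K)
  have hA1 : (1 : ℝ) ≤ A := by exact_mod_cast hA
  have hfin : {γ : Matrix.SpecialLinearGroup (Fin 4) ℤ |
      ∀ i j, |(γ : Matrix (Fin 4) (Fin 4) ℤ) i j| ≤ N}.Finite := by
    have h1 : (Set.Icc (fun _ _ => -(N : ℤ)) (fun _ _ => (N : ℤ)) :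
        Set (Fin 4 → Fin 4 → ℤ)).Finite := Set.finite_Icc _ _
    refine (h1.preimage (f := fun γ : Matrix.SpecialLinearGroup (Fin 4) ℤ =>
      ((γ : Matrix (Fin 4) (Fin 4) ℤ) : Fin 4 → Fin 4 → ℤ))
      (fun a _ b _ hab => Subtype.ext hab)).subset ?_
    intro γ hγ
    exact ⟨fun i j => (abs_le.mp (hγ i j)).1, fun i j => (abs_le.mp (hγ i j)).2⟩
  refine (hfin.biUnion (t := fun γ => {h : Matrix.SpecialLinearGroup (Fin 4) ℝ |
    gA A * (h : Matrix (Fin 4) (Fin 4) ℝ) = (toReal γ : Matrix (Fin 4) (Fin 4) ℝ) * gA A})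
    ?_).subset ?_
  · intro γ _
    apply Set.Subsingleton.finite
    intro a ha b hb
    apply Subtype.ext
    ext i j
    exact mul_left_cancel₀ (gA_pos hA i).ne' ((entry_rel ha i j).trans (entry_rel hb i j).symm)
  · rintro h ⟨⟨hG, γ, hγ, e⟩, hK⟩
    refine Set.mem_biUnion (x := γ) ?_ e
    intro i j
    have h1 := entry_rel e i j
    have hij := (abs_entry_le hG i j).trans hK
    have h7 : (1 : ℝ) ≤ √7 := Real.one_le_sqrt.mpr (by norm_num)
    have hsA : (1 : ℝ) ≤ √(A : ℝ) := Real.one_le_sqrt.mpr hA1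
    have hj : 1 ≤ ![√7, 1, 1, √(A : ℝ)] j := by fin_cases j <;> simp [hA1]
    have hi : ![√7, 1, 1, √(A : ℝ)] i ≤ √7 + √(A : ℝ) := by
      fin_cases i <;> simp <;> linarith
    have hi0 := (gA_pos hA i).le
    have : (|(γ : Matrix (Fin 4) (Fin 4) ℤ) i j| : ℝ) ≤ N := by
      calc (|(γ : Matrix (Fin 4) (Fin 4) ℤ) i j| : ℝ)
          ≤ |((γ : Matrix (Fin 4) (Fin 4) ℤ) i j : ℝ)| * ![√7, 1, 1, √(A : ℝ)] j :=
            le_mul_of_one_le_right (abs_nonneg _) hj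
        _ = |![√7, 1, 1, √(A : ℝ)] i * (h : Matrix (Fin 4) (Fin 4) ℝ) i j| := by
            rw [h1, abs_mul, abs_of_nonneg (zero_le_one.trans hj)]
        _ = ![√7, 1, 1, √(A : ℝ)] i * |(h : Matrix (Fin 4) (Fin 4) ℝ) i j| := by
            rw [abs_mul, abs_of_nonneg hi0]
        _ ≤ (√7 + √(A : ℝ)) * K := by
            apply mul_le_mul hi hij (abs_nonneg _) (by positivity)
        _ ≤ N := hN
    exact_mod_cast this

/-- The lattice acts properly discontinuously and freely on hyperbolic 3-space. -/
lemma exists_injectivity_radius {A : ℕ} (hA : 0 < A) (p : H3) :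
    ∃ r > 0, ∀ h ∈ Gam A, ∀ q : H3, q.1 = p.1 ᵥ* (h : Matrix (Fin 4) (Fin 4) ℝ) →
      H3.hdist p q < r → h = 1 := by
  let o : H3 := ⟨(1 : Matrix (Fin 4) (Fin 4) ℝ) 0, onH3_one_row⟩
  -- The entry (0, 0) is cosh d(o, oh), and d(o, oh) ≤ d(o, p) + d(p, ph) + d(ph, oh), where the
  -- last term equals d(o, p).
  have hfin := finite_entry_le hA (Real.cosh (2 * H3.hdist o p + 1))
  have hbd : ∀ h ∈ Gam A, ∀ q : H3, q.1 = p.1 ᵥ* (h : Matrix (Fin 4) (Fin 4) ℝ) →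
      H3.hdist p q < 1 → (h : Matrix (Fin 4) (Fin 4) ℝ) 0 0 ≤
        Real.cosh (2 * H3.hdist o p + 1) := by
    intro h hh q hq hd
    let o' : H3 := ⟨(h : Matrix (Fin 4) (Fin 4) ℝ) 0, onH3_row hh.1⟩
    have e1 : H3.hdist q o' = H3.hdist o p := by
      rw [H3.hdist_comm o p, H3.hdist_eq_iff, hq]
      have : o'.1 = o.1 ᵥ* (h : Matrix (Fin 4) (Fin 4) ℝ) := by
        change (h : Matrix (Fin 4) (Fin 4) ℝ) 0 = (1 : Matrix (Fin 4) (Fin 4) ℝ) 0 ᵥ* _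
        rw [← row_eq_vecMul, one_mul]
      rw [this, B_vecMul (G_le_SO31 hh.1)]
    have e2 : H3.hdist o o' ≤ 2 * H3.hdist o p + 1 := by
      linarith [H3.hdist_triangle o p o', H3.hdist_triangle p q o']
    have e3 : (h : Matrix (Fin 4) (Fin 4) ℝ) 0 0 = Real.cosh (H3.hdist o o') := by
      rw [H3.cosh_hdist]
      change _ = B ((1 : Matrix (Fin 4) (Fin 4) ℝ) 0) ((h : Matrix (Fin 4) (Fin 4) ℝ) 0)
      rw [one_row]
      simp [B]
    rw [e3, Real.cosh_le_cosh, abs_of_nonneg (H3.hdist_nonneg _ _)]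
    exact e2.trans (le_abs_self _)
  have hev : ∀ᶠ r : ℝ in nhdsWithin 0 (Set.Ioi 0), ∀ h ∈ {h | h ∈ Gam A ∧
      (h : Matrix (Fin 4) (Fin 4) ℝ) 0 0 ≤ Real.cosh (2 * H3.hdist o p + 1)},
      ∀ q : H3, q.1 = p.1 ᵥ* (h : Matrix (Fin 4) (Fin 4) ℝ) → H3.hdist p q < r → h = 1 := by
    rw [Filter.eventually_all_finite hfin]
    rintro h ⟨hh, -⟩
    let q : H3 := ⟨p.1 ᵥ* (h : Matrix (Fin 4) (Fin 4) ℝ), p.onH3.vecMul hh.1⟩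
    -- Each of the finitely many candidates either fixes p, hence is trivial, or moves p by a
    -- positive distance that excludes small r.
    rcases (H3.hdist_nonneg p q).eq_or_lt with h0 | h0
    · have h1 : h = 1 := eq_one_of_fixed hA hh p.onH3
        (congrArg Subtype.val (H3.eq_of_hdist_eq_zero h0.symm))
      exact Filter.Eventually.of_forall fun _ _ _ _ => h1
    · filter_upwards [nhdsWithin_le_nhds (Iio_mem_nhds h0)] with r hr q' hq' hd
      have : q' = q := Subtype.ext hq'
      rw [this] at hd
      exact absurd hd (not_lt.mpr (le_of_lt hr))
  obtain ⟨r, hr, hr0, hr1⟩ := (hev.and (Ioo_mem_nhdsGT (one_pos : (0 : ℝ) < 1))).exists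
  exact ⟨r, hr0, fun h hh q hq hd => hr h ⟨hh, hbd h hh q hq (hd.trans hr1)⟩ q hq hd⟩

/-! ### Frames, geodesics and linear isometric embeddings of the plane -/

/-- A Lorentz orthonormal basis of the subspace `x₄ = 0` whose first vector is `p`. -/
structure IsFrame (p u v : Fin 4 → ℝ) : Prop where
  p3 : p 3 = 0
  u3 : u 3 = 0
  v3 : v 3 = 0
  Qp : Q p = 1
  Qu : Q u = -1
  Qv : Q v = -1
  pu : B p u = 0
  pv : B p v = 0
  uv : B u v = 0
  expand : ∀ w : Fin 4 → ℝ, w 3 = 0 → w = B w p • p - B w u • u - B w v • v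

lemma exists_isFrame {p : Fin 4 → ℝ} (hp : OnH3 p) (h3 : p 3 = 0) :
    ∃ u v, IsFrame p u v := by
  have hF := boost_mul_eta hp
  have hB : ∀ i j, B (boost p i) (boost p j) = eta i j := by
    intro i j; rw [← mul_eta_mul_transpose_apply, hF]
  have e0 := boost_zero p
  have e3 : boost p 3 = ![0, 0, 0, 1] := by
    ext j
    fin_cases j <;> simp [boost, h3]
  refine ⟨boost p 1, boost p 2, h3, by simp [boost, h3], by simp [boost, h3], hp.1,
    by simp [← B_self, hB, eta], by simp [← B_self, hB, eta],
    by have := hB 0 1; rw [e0] at this; simpa [eta] using this,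
    by have := hB 0 2; rw [e0] at this; simpa [eta] using this,
    by simpa [eta] using hB 1 2, ?_⟩
  intro w hw
  have h := expand_of_mul_eta hF w
  have h4 : B w (boost p 3) = 0 := by rw [e3]; simp [B, hw]
  rwa [h4, zero_smul, sub_zero, e0] at h

/-- A unit tangent vector at a point of the plane is part of a Lorentz orthonormal basis. -/
lemma exists_isFrame_of_tangent {p u : Fin 4 → ℝ} (hp : OnH3 p) (h3 : p 3 = 0) (hu3 : u 3 = 0)
    (hu : Q u = -1) (hpu : B p u = 0) : ∃ v, IsFrame p u v := by
  obtain ⟨a, b, F⟩ := exists_isFrame hp h3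
  have e := F.expand u hu3
  rw [B_comm u p, hpu, zero_smul, zero_sub] at e
  set α := B u a
  set β := B u b
  have hαβ : α ^ 2 + β ^ 2 = 1 := by
    have h1 : Q u = - (α ^ 2 + β ^ 2) := by
      conv_lhs => rw [e]
      rw [← neg_smul, Q_smul_sub_smul, F.Qu, F.Qv, F.uv]; ring
    linarith
  -- Here u = -(αa + βb), and the witness is u turned by a right angle in the tangent plane.
  refine ⟨β • a - α • b, h3, hu3, by simp [F.u3, F.v3], hp.1, hu, ?_, hpu, ?_, ?_, ?_⟩
  · rw [Q_smul_sub_smul, F.Qu, F.Qv, F.uv]; linarith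
  · rw [B_sub_right, B_smul_right, B_smul_right, F.pu, F.pv]; ring
  · rw [B_sub_right, B_smul_right, B_smul_right]
    change β * α - α * β = 0
    ring
  · intro w hw
    have e1 := F.expand w hw
    have e2 : B w u = -(α * B w a) - β * B w b := by
      conv_lhs => rw [e]
      rw [← neg_smul, B_sub_right, B_smul_right, B_smul_right]; ring
    have e3 : B w (β • a - α • b) = β * B w a - α * B w b := by
      rw [B_sub_right, B_smul_right, B_smul_right]
    rw [e2, e3]
    conv_lhs => rw [e1]
    rw [e]
    ext i
    simp only [Pi.sub_apply, Pi.smul_apply, Pi.neg_apply, smul_eq_mul]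
    linear_combination (B w a * a i + B w b * b i) * hαβ

/-- The point at time `t` on the geodesic from `p` with initial velocity `u`. -/
def geo (p u : Fin 4 → ℝ) (t : ℝ) : Fin 4 → ℝ := Real.cosh t • p + Real.sinh t • u

lemma B_geo_right (w p u : Fin 4 → ℝ) (t : ℝ) :
    B w (geo p u t) = Real.cosh t * B w p + Real.sinh t * B w u := by
  rw [geo, B_add_right, B_smul_right, B_smul_right]

lemma B_geo_geo {p u : Fin 4 → ℝ} (hp : Q p = 1) (hu : Q u = -1) (h : B p u = 0) (s t : ℝ) :
    B (geo p u s) (geo p u t) = Real.cosh (s - t) := by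
  rw [B_geo_right, B_comm _ p, B_comm _ u, B_geo_right, B_geo_right, B_self, B_self, B_comm u p,
    hp, hu, h, Real.cosh_sub]
  ring

lemma onH3_geo {p u : Fin 4 → ℝ} (hp : OnH3 p) (hu : Q u = -1) (h : B p u = 0) (t : ℝ) :
    OnH3 (geo p u t) := by
  refine hp.of_B_pos ?_ ?_
  · rw [← B_self, B_geo_geo hp.1 hu h, sub_self, Real.cosh_zero]
  · rw [B_geo_right, B_self, hp.1, h, mul_one, mul_zero, add_zero]
    exact Real.cosh_pos t

/-- Linear maps that restrict to an isometric embedding of the hyperbolic plane into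
hyperbolic 3-space. -/
structure IsLorentz (L : (Fin 4 → ℝ) →ₗ[ℝ] (Fin 4 → ℝ)) : Prop where
  B_map : ∀ u v : Fin 4 → ℝ, u 3 = 0 → v 3 = 0 → B (L u) (L v) = B u v
  onH3 : ∀ p : Fin 4 → ℝ, OnH3 p → p 3 = 0 → OnH3 (L p)

/-- The isometric embedding of the hyperbolic plane defined by a linear map. -/
def IsLorentz.embed {L : (Fin 4 → ℝ) →ₗ[ℝ] (Fin 4 → ℝ)} (hL : IsLorentz L) (x : H2) : H3 :=
  ⟨L x.1.1, hL.onH3 x.1.1 x.1.2 x.2⟩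

lemma IsLorentz.hdist_embed {L : (Fin 4 → ℝ) →ₗ[ℝ] (Fin 4 → ℝ)} (hL : IsLorentz L) (x y : H2) :
    H3.hdist (hL.embed x) (hL.embed y) = H2.hdist x y :=
  H3.hdist_eq_iff.mpr (hL.B_map _ _ x.2 y.2)

/-- A distance preserving map from a part of the hyperbolic plane that contains a small
orthogonal pair of geodesic segments extends to a linear map. -/
lemma exists_isLorentz_of_isometric {p u v : Fin 4 → ℝ} (hp : OnH3 p) (F : IsFrame p u v)
    {t : ℝ} (ht : 0 < t) {X Y Z : Fin 4 → ℝ} (hX : OnH3 X) (hY : Q Y = 1) (hZ : Q Z = 1)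
    (hXY : B X Y = B p (geo p u t)) (hXZ : B X Z = B p (geo p v t))
    (hYZ : B Y Z = B (geo p u t) (geo p v t)) :
    ∃ L, IsLorentz L ∧ ∀ z z' : Fin 4 → ℝ, OnH3 z → z 3 = 0 → OnH3 z' →
      B z' X = B z p → B z' Y = B z (geo p u t) → B z' Z = B z (geo p v t) → z' = L z := by
  have hs : Real.sinh t ≠ 0 := (Real.sinh_pos_iff.mpr ht).ne'
  have hcs : Real.cosh t ^ 2 = Real.sinh t ^ 2 + 1 := by
    linarith [Real.cosh_sq t]
  rw [B_geo_right, B_self, F.Qp, F.pu, mul_zero, add_zero, mul_one] at hXY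
  rw [B_geo_right, B_self, F.Qp, F.pv, mul_zero, add_zero, mul_one] at hXZ
  rw [B_geo_right, B_comm _ p, B_comm _ v, B_geo_right, B_geo_right, B_self, F.Qp, F.pu,
    B_comm v p, F.pv, B_comm v u, F.uv] at hYZ
  set c := Real.cosh t
  set s := Real.sinh t
  -- U and V are the initial velocities of the geodesics from X that reach Y and Z at time t.
  set U := s⁻¹ • (Y - c • X) with hU
  set V := s⁻¹ • (Z - c • X) with hV
  have hXU : B X U = 0 := by
    rw [hU, B_smul_right, B_sub_right, B_smul_right, B_self, hX.1, hXY]; ring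
  have hXV : B X V = 0 := by
    rw [hV, B_smul_right, B_sub_right, B_smul_right, B_self, hX.1, hXZ]; ring
  have hUU : B U U = -1 := by
    rw [hU, B_smul_right, B_smul_left, B_self, Q_sub_smul, B_comm Y X, hX.1, hY, hXY]
    field_simp; linarith
  have hVV : B V V = -1 := by
    rw [hV, B_smul_right, B_smul_left, B_self, Q_sub_smul, B_comm Z X, hX.1, hZ, hXZ]
    field_simp; linarith
  have hUV : B U V = 0 := by
    rw [hU, hV, B_smul_right, B_smul_left, B_sub_right, B_sub_left, B_sub_left, B_smul_right,
      B_smul_right, B_smul_left, B_smul_left, B_self, B_comm Y X, hX.1, hXY, hXZ, hYZ]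
    ring
  clear_value U V
  let L : (Fin 4 → ℝ) →ₗ[ℝ] (Fin 4 → ℝ) :=
    { toFun := fun w => B w p • X - B w u • U - B w v • V
      map_add' := by
        intro a b
        simp only [B_add_left, add_smul]; abel
      map_smul' := by
        intro r a
        simp only [B_smul_left, mul_smul, smul_sub, RingHom.id_apply] }
  have hLdef : ∀ w, L w = B w p • X - B w u • U - B w v • V := fun _ => rfl
  have hBL : ∀ w w', B w' (L w) = B w p * B w' X - B w u * B w' U - B w v * B w' V := by
    intro w w'
    rw [hLdef, B_sub_right, B_sub_right, B_smul_right, B_smul_right, B_smul_right]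
  have hBW : ∀ w w', w 3 = 0 → B w' w = B w p * B w' p - B w u * B w' u - B w v * B w' v := by
    intro w w' hw
    conv_lhs => rw [F.expand w hw]
    rw [B_sub_right, B_sub_right, B_smul_right, B_smul_right, B_smul_right]
  have hmap : ∀ a b : Fin 4 → ℝ, a 3 = 0 → b 3 = 0 → B (L a) (L b) = B a b := by
    intro a b ha hb
    rw [hBL, B_comm _ X, B_comm _ U, B_comm _ V, hBL, hBL, hBL, hBW b a hb, B_self, hX.1, hUU,
      hVV, B_comm U X, B_comm V X, B_comm V U, hXU, hXV, hUV]
    ring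
  have hLp : L p = X := by
    rw [hLdef, B_self, F.Qp, F.pu, F.pv]; simp
  refine ⟨L, ⟨hmap, ?_⟩, ?_⟩
  · intro q hq hq3
    refine hX.of_B_pos ?_ ?_
    · rw [← B_self, hmap q q hq3 hq3, B_self, hq.1]
    · rw [← hLp, hmap p q F.p3 hq3]
      linarith [hp.one_le_B hq]
  · intro z z' hz hz3 hz' h1 h2 h3
    have hLz : OnH3 (L z) := by
      refine hX.of_B_pos ?_ ?_
      · rw [← B_self, hmap z z hz3 hz3, B_self, hz.1]
      · rw [← hLp, hmap p z F.p3 hz3]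
        linarith [hp.one_le_B hz]
    -- The three products determine z' only up to a component orthogonal to X, U and V; that B(L z,
    -- z') is 1 for two points of the hyperboloid excludes such a component.
    refine hLz.eq_of_B_eq_one hz' ?_
    have hzU : B z' U = B z u := by
      rw [hU, B_smul_right, B_sub_right, B_smul_right, h1, h2, B_geo_right]
      change s⁻¹ * (c * B z p + s * B z u - c * B z p) = _
      field_simp; ring
    have hzV : B z' V = B z v := by
      rw [hV, B_smul_right, B_sub_right, B_smul_right, h1, h3, B_geo_right]
      change s⁻¹ * (c * B z p + s * B z v - c * B z p) = _
      field_simp; ring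
    rw [B_comm, hBL, h1, hzU, hzV, ← hBW z z hz3, B_self, hz.1]

/-! ### The quotient metric and local lifts -/

/-- The action of an element of `G` on hyperbolic 3-space. -/
def H3.move (p : H3) {h : Matrix.SpecialLinearGroup (Fin 4) ℝ} (hh : h ∈ G) : H3 :=
  ⟨p.1 ᵥ* (h : Matrix (Fin 4) (Fin 4) ℝ), p.onH3.vecMul hh⟩

lemma H3.hdist_move (p q : H3) {h : Matrix.SpecialLinearGroup (Fin 4) ℝ} (hh : h ∈ G) :
    H3.hdist (p.move hh) (q.move hh) = H3.hdist p q :=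
  H3.hdist_eq_iff.mpr (B_vecMul (G_le_SO31 hh) _ _)

lemma rho_move {A : ℕ} (p : H3) {h : Matrix.SpecialLinearGroup (Fin 4) ℝ} (hh : h ∈ Gam A) :
    rho A (p.move hh.1) = rho A p :=
  (rho_eq_iff.mpr ⟨h, hh, rfl⟩).symm

lemma exists_move_of_rho_eq {A : ℕ} {p q : H3} (h : rho A p = rho A q) :
    ∃ g, ∃ hg : g ∈ Gam A, q = p.move hg.1 := by
  obtain ⟨g, hg, e⟩ := rho_eq_iff.mp h
  exact ⟨g, hg, Subtype.ext e⟩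

lemma M.dist_le {A : ℕ} (p q : H3) : M.dist (rho A p) (rho A q) ≤ H3.hdist p q := by
  refine csInf_le ⟨0, ?_⟩ ⟨p, rfl, q, rfl, rfl⟩
  rintro _ ⟨a, -, b, -, rfl⟩
  exact H3.hdist_nonneg a b

/-- The quotient distance is an infimum over pairs of lifts; a pair close to it is moved by the
lattice so that its first member becomes p. -/
lemma M.exists_lift_of_dist_lt {A : ℕ} {p : H3} {m : M A} {δ : ℝ}
    (h : M.dist (rho A p) m < δ) : ∃ q, rho A q = m ∧ H3.hdist p q < δ := by
  obtain ⟨q₀, hq₀⟩ : ∃ q₀, rho A q₀ = m := Quotient.exists_rep m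
  obtain ⟨_, ⟨a, ha, b, hb, rfl⟩, hlt⟩ := exists_lt_of_csInf_lt
    (s := Set.image2 H3.hdist (rho A ⁻¹' {rho A p}) (rho A ⁻¹' {m}))
    ⟨_, p, rfl, q₀, hq₀, rfl⟩ h
  obtain ⟨g, hg, rfl⟩ := exists_move_of_rho_eq (show rho A a = rho A p from ha)
  exact ⟨b.move hg.1, (rho_move b hg).trans hb, by rwa [H3.hdist_move]⟩

/-- The projection is an isometry on balls whose radius is a quarter of the injectivity radius. -/
lemma M.dist_eq_of_hdist_lt {A : ℕ} {p : H3} {r : ℝ}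
    (hr : ∀ h ∈ Gam A, ∀ q : H3, q.1 = p.1 ᵥ* (h : Matrix (Fin 4) (Fin 4) ℝ) →
      H3.hdist p q < r → h = 1) {a b : H3} (ha : H3.hdist p a < r / 4) (hb : H3.hdist p b < r / 4) :
    M.dist (rho A a) (rho A b) = H3.hdist a b := by
  refine le_antisymm (M.dist_le a b) ?_
  by_contra! hlt
  obtain ⟨c, hc, hd⟩ := M.exists_lift_of_dist_lt hlt
  obtain ⟨g, hg, rfl⟩ := exists_move_of_rho_eq hc.symm
  -- The path p, a, bg, pg bounds d(p, pg), with d(a, bg) < d(a, b) ≤ d(a, p) + d(p, b): four terms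
  -- below r/4 in all.
  have h1 : g = 1 := by
    refine hr g hg (p.move hg.1) rfl ?_
    have t1 := H3.hdist_triangle p a (p.move hg.1)
    have t2 := H3.hdist_triangle a (b.move hg.1) (p.move hg.1)
    have t3 := H3.hdist_triangle a p b
    rw [H3.hdist_move, H3.hdist_comm b p] at t2
    rw [H3.hdist_comm a p] at t3
    linarith
  have h2 : b.move hg.1 = b := Subtype.ext (by simp [H3.move, h1])
  rw [h2] at hd
  exact lt_irrefl _ hd

lemma H2.onH3 (x : H2) : OnH3 x.1.1 := x.1.2

lemma geo_apply_three {p u : Fin 4 → ℝ} (hp : p 3 = 0) (hu : u 3 = 0) (t : ℝ) :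
    geo p u t 3 = 0 := by
  simp [geo, hp, hu]

/-- The geodesic of the hyperbolic plane from `x` with initial velocity `u`. -/
def H2.geodesic (x : H2) {u : Fin 4 → ℝ} (hu3 : u 3 = 0) (hu : Q u = -1) (h : B x.1.1 u = 0)
    (t : ℝ) : H2 :=
  ⟨⟨geo x.1.1 u t, onH3_geo x.onH3 hu h t⟩, geo_apply_three x.2 hu3 t⟩

lemma H2.hdist_geodesic (x : H2) {u : Fin 4 → ℝ} (hu3 : u 3 = 0) (hu : Q u = -1)
    (h : B x.1.1 u = 0) (s t : ℝ) :
    H2.hdist (x.geodesic hu3 hu h s) (x.geodesic hu3 hu h t) = |s - t| := by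
  have e : B (x.geodesic hu3 hu h s).1.1 (x.geodesic hu3 hu h t).1.1 = Real.cosh |s - t| := by
    rw [Real.cosh_abs]; exact B_geo_geo x.onH3.1 hu h s t
  rw [H2.hdist, H3.hdist, e, Real.arcosh_cosh (abs_nonneg _)]

lemma H2.geodesic_zero (x : H2) {u : Fin 4 → ℝ} (hu3 : u 3 = 0) (hu : Q u = -1)
    (h : B x.1.1 u = 0) : x.geodesic hu3 hu h 0 = x := by
  apply Subtype.ext
  apply Subtype.ext
  simp [H2.geodesic, geo]

/-- Locally, a local isometry lifts to the restriction of a linear map. -/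
lemma exists_local_lift {A : ℕ} (hA : 0 < A) {ζ : H2 → M A} (hζ : IsLocallyIsometric ζ) (x : H2) :
    ∃ L, ∃ hL : IsLorentz L, ∃ δ > 0, ∀ y, H2.hdist x y < δ → ζ y = rho A (hL.embed y) := by
  obtain ⟨ε, hε, hiso⟩ := hζ x
  obtain ⟨p, hp⟩ : ∃ p, rho A p = ζ x := Quotient.exists_rep (ζ x)
  obtain ⟨r, hr0, hr⟩ := exists_injectivity_radius hA p
  have hself : H2.hdist x x = 0 := by
    rw [H2.hdist, H3.hdist, B_self, x.1.2.1, Real.arcosh_zero]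
  -- Below ε the map ζ preserves distances, and below r/4 the projection does, so the chosen lifts f
  -- preserve them too.
  set δ := min ε (r / 4) with hδ
  have hδ0 : 0 < δ := lt_min hε (by linarith)
  have hex : ∀ y, ∃ q : H3, H2.hdist x y < δ → rho A q = ζ y ∧ H3.hdist p q < δ := by
    intro y
    by_cases hy : H2.hdist x y < δ
    · obtain ⟨q, h1, h2⟩ := M.exists_lift_of_dist_lt (p := p) (m := ζ y) (δ := δ) (by
        rw [hp, hiso x y (by rwa [hself]) (hy.trans_le (min_le_left _ _))]; exact hy)
      exact ⟨q, fun _ => ⟨h1, h2⟩⟩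
    · exact ⟨p, fun h => absurd h hy⟩
  choose f hf using hex
  have hfiso : ∀ y z, H2.hdist x y < δ → H2.hdist x z < δ → B (f y).1 (f z).1 = B y.1.1 z.1.1 := by
    intro y z hy hz
    have h1 := M.dist_eq_of_hdist_lt hr ((hf y hy).2.trans_le (min_le_right _ _))
      ((hf z hz).2.trans_le (min_le_right _ _))
    rw [(hf y hy).1, (hf z hz).1, hiso y z (hy.trans_le (min_le_left _ _))
      (hz.trans_le (min_le_left _ _))] at h1
    exact (H3.hdist_eq_iff.mp h1).symm
  obtain ⟨u, v, F⟩ := exists_isFrame x.onH3 x.2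
  have ht : 0 < δ / 2 := by linarith
  let y := x.geodesic F.u3 F.Qu F.pu (δ / 2)
  let z := x.geodesic F.v3 F.Qv F.pv (δ / 2)
  have hx : H2.hdist x x < δ := by rwa [hself]
  have hy : H2.hdist x y < δ := by
    have := x.hdist_geodesic F.u3 F.Qu F.pu 0 (δ / 2)
    rw [H2.geodesic_zero, zero_sub, abs_neg, abs_of_pos ht] at this
    exact this.trans_lt (by linarith)
  have hz : H2.hdist x z < δ := by
    have := x.hdist_geodesic F.v3 F.Qv F.pv 0 (δ / 2)
    rw [H2.geodesic_zero, zero_sub, abs_neg, abs_of_pos ht] at this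
    exact this.trans_lt (by linarith)
  obtain ⟨L, hL, hext⟩ := exists_isLorentz_of_isometric x.onH3 F ht (f x).onH3 (f y).2.1 (f z).2.1
    (hfiso x y hx hy) (hfiso x z hx hz) (hfiso y z hy hz)
  refine ⟨L, hL, δ, hδ0, fun w hw => ?_⟩
  rw [← (hf w hw).1]
  congr 1
  exact Subtype.ext (hext w.1.1 (f w).1 w.onH3 w.2 (f w).onH3 (hfiso w x hw hx) (hfiso w y hw hy)
    (hfiso w z hw hz))

/-! ### Continuation to a global lift -/

/-- The hyperbolic plane as a graph over its second and third coordinates. -/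
def chart (c : ℝ × ℝ) : H2 :=
  ⟨⟨![√(1 + c.1 ^ 2 + c.2 ^ 2), c.1, c.2, 0], by
    simp only [Q, Matrix.cons_val_zero, Matrix.cons_val_one, Matrix.cons_val]
    rw [Real.sq_sqrt (by positivity)]; ring, by
    simp only [Matrix.cons_val_zero]; positivity⟩, rfl⟩

/-- The inverse of `chart`. -/
def coords (p : Fin 4 → ℝ) : ℝ × ℝ := (p 1, p 2)

lemma chart_coords (x : H2) : chart (coords x.1.1) = x := by
  apply Subtype.ext
  apply Subtype.ext
  have h1 := x.1.2.1
  have h2 := x.1.2.2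
  have h3 := x.2
  have e : √(1 + x.1.1 1 ^ 2 + x.1.1 2 ^ 2) = x.1.1 0 := by
    rw [← Real.sqrt_sq h2.le]
    congr 1
    simp only [Q, h3] at h1
    linarith
  ext i
  fin_cases i
  · exact e
  · rfl
  · rfl
  · exact h3.symm

/-- `H2` carries no topology here; the chart lets the connectedness of ℝ × ℝ be used instead. -/
lemma eventually_hdist_chart_lt (c : ℝ × ℝ) {r : ℝ} (hr : 0 < r) :
    ∀ᶠ c' in 𝓝 c, H2.hdist (chart c) (chart c') < r := by
  have hc : Continuous fun c' => B (chart c).1.1 (chart c').1.1 := by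
    simp only [B, chart, Matrix.cons_val_zero, Matrix.cons_val_one, Matrix.cons_val]
    fun_prop
  have h1 : B (chart c).1.1 (chart c).1.1 < Real.cosh r := by
    rw [B_self, (chart c).1.2.1]
    exact Real.one_lt_cosh.mpr hr.ne'
  filter_upwards [hc.continuousAt.eventually (Iio_mem_nhds h1)] with c' hc'
  exact (H3.hdist_lt_iff _ _ hr).mpr hc'

lemma tendsto_coords_geo (p u : Fin 4 → ℝ) :
    Tendsto (fun t => coords (geo p u t)) (𝓝 0) (𝓝 (coords p)) := by
  have hc : Continuous fun t => coords (geo p u t) := by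
    simp only [coords, geo, Pi.add_apply, Pi.smul_apply]
    have := Real.continuous_cosh
    have := Real.continuous_sinh
    fun_prop
  simpa [geo] using hc.tendsto 0

/-- Two linear lifts that agree near a point modulo the lattice agree everywhere modulo it. -/
lemma rho_embed_eq_of_eventually {A : ℕ} (hA : 0 < A) {L L' : (Fin 4 → ℝ) →ₗ[ℝ] (Fin 4 → ℝ)}
    (hL : IsLorentz L) (hL' : IsLorentz L') (c : ℝ × ℝ)
    (h : ∀ᶠ c' in 𝓝 c, rho A (hL.embed (chart c')) = rho A (hL'.embed (chart c'))) (y : H2) :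
    rho A (hL.embed y) = rho A (hL'.embed y) := by
  set x := chart c with hx
  obtain ⟨r, hr0, hr⟩ := exists_injectivity_radius hA (hL.embed x)
  obtain ⟨g, hg, hgx⟩ := exists_move_of_rho_eq h.self_of_nhds
  have hev : ∀ᶠ c' in 𝓝 c, hL'.embed (chart c') = (hL.embed (chart c')).move hg.1 := by
    filter_upwards [h, eventually_hdist_chart_lt c (half_pos hr0)] with c' hc' hd
    obtain ⟨k, hk, hkx⟩ := exists_move_of_rho_eq hc'
    suffices hgk : g * k⁻¹ = 1 by
      have : g = k := mul_inv_eq_one.mp hgk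
      subst this
      exact hkx
    have hgk : g * k⁻¹ ∈ Gam A := mul_mem hg (inv_mem hk)
    -- After applying k, the displacement is at most twice the distance from x to the nearby point,
    -- hence less than r.
    refine hr _ hgk ((hL.embed x).move hgk.1) rfl ?_
    have e : ((hL.embed x).move hgk.1).move hk.1 = (hL.embed x).move hg.1 := by
      apply Subtype.ext
      change (L x.1.1 ᵥ* ((g * k⁻¹ : Matrix.SpecialLinearGroup (Fin 4) ℝ) :
        Matrix (Fin 4) (Fin 4) ℝ)) ᵥ* (k : Matrix (Fin 4) (Fin 4) ℝ) =
        L x.1.1 ᵥ* (g : Matrix (Fin 4) (Fin 4) ℝ)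
      rw [Matrix.vecMul_vecMul, ← Matrix.SpecialLinearGroup.coe_mul, inv_mul_cancel_right]
    rw [← H3.hdist_move _ _ hk.1, e, ← hgx]
    have t := H3.hdist_triangle ((hL.embed x).move hk.1) ((hL.embed (chart c')).move hk.1)
      (hL'.embed x)
    rw [H3.hdist_move, ← hkx, hL.hdist_embed, hL'.hdist_embed] at t
    have : H2.hdist (chart c') x = H2.hdist x (chart c') := H3.hdist_comm _ _
    linarith
  obtain ⟨u, v, F⟩ := exists_isFrame x.onH3 x.2
  have key : ∀ w (hw3 : w 3 = 0) (hQ : Q w = -1) (hB : B x.1.1 w = 0),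
      L' w = L w ᵥ* (g : Matrix (Fin 4) (Fin 4) ℝ) := by
    intro w hw3 hQ hB
    have h1 : ∀ᶠ t in 𝓝 (0 : ℝ), hL'.embed (x.geodesic hw3 hQ hB t) =
        (hL.embed (x.geodesic hw3 hQ hB t)).move hg.1 := by
      filter_upwards [(tendsto_coords_geo x.1.1 w).eventually (p := fun c' =>
        hL'.embed (chart c') = (hL.embed (chart c')).move hg.1) hev] with t ht
      have e := chart_coords (x.geodesic hw3 hQ hB t)
      change chart (coords (geo x.1.1 w t)) = _ at e
      rwa [e] at ht
    -- One positive t suffices: the identity at x cancels the cosh terms, and sinh t is nonzero.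
    obtain ⟨t, ht, ht0⟩ :=
      ((h1.filter_mono (nhdsWithin_le_nhds (s := Set.Ioi 0))).and self_mem_nhdsWithin).exists
    have e1 : L' (geo x.1.1 w t) = L (geo x.1.1 w t) ᵥ* (g : Matrix (Fin 4) (Fin 4) ℝ) :=
      congrArg Subtype.val ht
    have e2 : L' x.1.1 = L x.1.1 ᵥ* (g : Matrix (Fin 4) (Fin 4) ℝ) := congrArg Subtype.val hgx
    simp only [geo, map_add, map_smul, Matrix.add_vecMul, Matrix.smul_vecMul, e2] at e1
    exact smul_right_injective _ (Real.sinh_pos_iff.mpr ht0).ne' (add_left_cancel e1)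
  refine rho_eq_iff.mpr ⟨g, hg, ?_⟩
  change L' y.1.1 = L y.1.1 ᵥ* (g : Matrix (Fin 4) (Fin 4) ℝ)
  have e2 : L' x.1.1 = L x.1.1 ᵥ* (g : Matrix (Fin 4) (Fin 4) ℝ) := congrArg Subtype.val hgx
  rw [F.expand y.1.1 y.2]
  simp only [map_sub, map_smul, Matrix.sub_vecMul, Matrix.smul_vecMul, e2,
    key u F.u3 F.Qu F.pu, key v F.v3 F.Qv F.pv]

/-- A local isometry of the hyperbolic plane into the manifold lifts to a linear map. -/
theorem exists_lift {A : ℕ} (hA : 0 < A) {ζ : H2 → M A} (hζ : IsLocallyIsometric ζ) :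
    ∃ L, ∃ hL : IsLorentz L, ∀ y, ζ y = rho A (hL.embed y) := by
  have hloc : ∀ c, ∃ L, ∃ hL : IsLorentz L,
      ∀ᶠ c' in 𝓝 c, ζ (chart c') = rho A (hL.embed (chart c')) := by
    intro c
    obtain ⟨L, hL, δ, hδ, h⟩ := exists_local_lift hA hζ (chart c)
    exact ⟨L, hL, (eventually_hdist_chart_lt c hδ).mono fun c' hc' => h _ hc'⟩
  obtain ⟨L, hL, h0⟩ := hloc 0
  refine ⟨L, hL, ?_⟩
  have huniv : {c | ∀ᶠ c' in 𝓝 c, ζ (chart c') = rho A (hL.embed (chart c'))} = Set.univ := by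
    refine IsClopen.eq_univ ⟨?_, isOpen_setOfPred_eventually_nhds⟩ ⟨0, h0⟩
    -- Near a limit point c there is a d in the set at which L and the local lift at c both describe
    -- ζ nearby; they then agree modulo the lattice everywhere, in particular near c.
    refine isClosed_of_closure_subset fun c hc => ?_
    obtain ⟨L', hL', h'⟩ := hloc c
    obtain ⟨d, hd', hd⟩ := mem_closure_iff_nhds.mp hc _ (eventually_eventually_nhds.mpr h')
    have heq := rho_embed_eq_of_eventually hA hL hL' d (by
      filter_upwards [hd, hd'] with c' h1 h2
      rw [← h1, ← h2])
    filter_upwards [h'] with c' h1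
    rw [h1, heq]
  intro y
  have := (huniv ▸ Set.mem_univ (coords y.1.1) :
    coords y.1.1 ∈ {c | ∀ᶠ c' in 𝓝 c, ζ (chart c') = rho A (hL.embed (chart c'))}).self_of_nhds
  rwa [chart_coords] at this

/-! ### Lines and zero sets of linear functionals -/

/-- An isometrically parametrized line is a geodesic in the hyperboloid model. -/
lemma H2.exists_geodesic_of_isometry {c : ℝ → H2}
    (hc : ∀ s t : ℝ, H2.hdist (c s) (c t) = |s - t|) (a : ℝ) :
    ∃ u, u 3 = 0 ∧ Q u = -1 ∧ B (c a).1.1 u = 0 ∧ ∀ t, (c (a + t)).1.1 = geo (c a).1.1 u t := by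
  have hB : ∀ s t, B (c s).1.1 (c t).1.1 = Real.cosh (s - t) := by
    intro s t
    rw [← Real.cosh_abs, ← hc s t]
    exact (H3.cosh_hdist _ _).symm
  have hs : Real.sinh 1 ≠ 0 := (Real.sinh_pos_iff.mpr one_pos).ne'
  have hcs : Real.cosh 1 ^ 2 = Real.sinh 1 ^ 2 + 1 := by linarith [Real.cosh_sq 1]
  have h1 : B (c a).1.1 (c (a + 1)).1.1 = Real.cosh 1 := by
    rw [hB, ← Real.cosh_neg]; congr 1; ring
  have hQ : ∀ t, Q (c t).1.1 = 1 := fun t => (c t).1.2.1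
  set u : Fin 4 → ℝ := (Real.sinh 1)⁻¹ • ((c (a + 1)).1.1 - Real.cosh 1 • (c a).1.1) with hu
  have hu3 : u 3 = 0 := by
    simp [hu, (c (a + 1)).2, (c a).2]
  have hpu : B (c a).1.1 u = 0 := by
    rw [hu, B_smul_right, B_sub_right, B_smul_right, B_self, hQ, h1]; ring
  have hQu : Q u = -1 := by
    rw [← B_self, hu, B_smul_right, B_smul_left, B_self, Q_sub_smul, B_comm _ (c a).1.1, hQ, hQ,
      h1]
    field_simp; linarith
  refine ⟨u, hu3, hQu, hpu, fun t => ?_⟩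
  refine (onH3_geo (c a).onH3 hQu hpu t).eq_of_B_eq_one (c (a + t)).onH3 ?_
  have h2 : B (c (a + t)).1.1 (c a).1.1 = Real.cosh t := by rw [hB]; congr 1; ring
  have h3 : B (c (a + t)).1.1 u = -Real.sinh t := by
    rw [hu, B_smul_right, B_sub_right, B_smul_right, h2, hB, show a + t - (a + 1) = t - 1 by ring,
      Real.cosh_sub]
    field_simp; ring
  rw [B_comm, B_geo_right, h2, h3]
  linarith [Real.cosh_sq t]

/-- A linear functional that vanishes at two points of a line vanishes on the line. -/
lemma H2.IsLine.subset_of_two_points {l : Set H2} (hl : H2.IsLine l)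
    (φ : (Fin 4 → ℝ) →ₗ[ℝ] ℝ) {x y : H2} (hx : x ∈ l) (hy : y ∈ l) (hxy : x ≠ y)
    (h1 : φ x.1.1 = 0) (h2 : φ y.1.1 = 0) : ∀ z ∈ l, φ z.1.1 = 0 := by
  obtain ⟨c, hc, rfl⟩ := hl
  obtain ⟨a, rfl⟩ := hx
  obtain ⟨b, rfl⟩ := hy
  obtain ⟨u, -, -, -, hu⟩ := H2.exists_geodesic_of_isometry hc a
  have hab : b - a ≠ 0 := fun h => hxy (by rw [sub_eq_zero.mp h])
  have e : φ (geo (c a).1.1 u (b - a)) = 0 := by rw [← hu, add_sub_cancel, h2]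
  have hφu : φ u = 0 := by
    simp only [geo, map_add, map_smul, h1, mul_zero, zero_add, smul_eq_mul] at e
    exact (mul_eq_zero.mp e).resolve_left (Real.sinh_ne_zero.mpr hab)
  rintro _ ⟨t, rfl⟩
  rw [← add_sub_cancel a t, hu]
  simp [geo, h1, hφu]

/-- A line on which a linear functional vanishes is its full zero set, unless the functional
vanishes on the whole plane. -/
lemma H2.IsLine.mem_of_apply_eq_zero {l : Set H2} (hl : H2.IsLine l)
    (φ : (Fin 4 → ℝ) →ₗ[ℝ] ℝ) (h : ∀ z ∈ l, φ z.1.1 = 0) {w : H2} (hw : φ w.1.1 ≠ 0)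
    {y : H2} (hy : φ y.1.1 = 0) : y ∈ l := by
  obtain ⟨c, hc, rfl⟩ := hl
  obtain ⟨u, hu3, hQu, hpu, hu⟩ := H2.exists_geodesic_of_isometry hc 0
  have h0 : φ (c 0).1.1 = 0 := h _ ⟨0, rfl⟩
  have h1 : φ u = 0 := by
    have e : φ (geo (c 0).1.1 u 1) = 0 := by rw [← hu]; exact h _ ⟨_, rfl⟩
    simp only [geo, map_add, map_smul, h0, mul_zero, zero_add, smul_eq_mul] at e
    exact (mul_eq_zero.mp e).resolve_left (Real.sinh_ne_zero.mpr one_ne_zero)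
  -- With v normal to the line, the functional is a nonzero multiple of B(·, v) on the plane, so its
  -- zeros there lie in the span of `c 0` and u.
  obtain ⟨v, F⟩ := exists_isFrame_of_tangent (c 0).onH3 (c 0).2 hu3 hQu hpu
  have hv : φ v ≠ 0 := by
    intro hv
    apply hw
    rw [F.expand w.1.1 w.2]
    simp [h0, h1, hv]
  have hyv : B y.1.1 v = 0 := by
    have e := F.expand y.1.1 y.2
    have e1 : φ y.1.1 = -(B y.1.1 v * φ v) := by
      conv_lhs => rw [e]
      simp [h0, h1]
    rw [hy] at e1
    exact (mul_eq_zero.mp (neg_eq_zero.mp e1.symm)).resolve_right hv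
  have hexp := F.expand y.1.1 y.2
  rw [hyv, zero_smul, sub_zero] at hexp
  have hsq : B y.1.1 (c 0).1.1 ^ 2 - B y.1.1 u ^ 2 = 1 := by
    have e := y.1.2.1
    rw [hexp, Q_smul_sub_smul, (c 0).1.2.1, hQu, hpu] at e
    linarith
  refine ⟨Real.arsinh (-B y.1.1 u), ?_⟩
  apply Subtype.ext
  apply Subtype.ext
  rw [← zero_add (Real.arsinh _), hu, geo, Real.sinh_arsinh, Real.cosh_arsinh]
  have e : √(1 + (-B y.1.1 u) ^ 2) = B y.1.1 (c 0).1.1 := by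
    rw [← Real.sqrt_sq (zero_le_one.trans (y.onH3.one_le_B (c 0).onH3))]
    congr 1
    linarith
  rw [e]
  conv_rhs => rw [hexp]
  rw [neg_smul, sub_eq_add_neg]

/-- Through every zero of a linear functional there passes a line on which it vanishes. -/
lemma H2.exists_line_of_apply_eq_zero (φ : (Fin 4 → ℝ) →ₗ[ℝ] ℝ) (x : H2) (hx : φ x.1.1 = 0) :
    ∃ l, H2.IsLine l ∧ x ∈ l ∧ ∀ y ∈ l, φ y.1.1 = 0 := by
  obtain ⟨a, b, F⟩ := exists_isFrame x.onH3 x.2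
  obtain ⟨u, hu3, hQu, hpu, hφ⟩ : ∃ u : Fin 4 → ℝ, u 3 = 0 ∧ Q u = -1 ∧ B x.1.1 u = 0 ∧
      φ u = 0 := by
    -- The direction is the gradient (φ a, φ b) turned by a right angle; if the gradient is zero, φ
    -- vanishes on the whole plane and any direction serves.
    by_cases h : φ a ^ 2 + φ b ^ 2 = 0
    · exact ⟨a, F.u3, F.Qu, F.pu, by nlinarith [sq_nonneg (φ a), sq_nonneg (φ b)]⟩
    · have hpos : 0 < φ a ^ 2 + φ b ^ 2 := lt_of_le_of_ne (by positivity) (Ne.symm h)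
      set n := √(φ a ^ 2 + φ b ^ 2) with hn
      have hn0 : n ≠ 0 := (Real.sqrt_pos.mpr hpos).ne'
      have hn2 : n ^ 2 = φ a ^ 2 + φ b ^ 2 := Real.sq_sqrt hpos.le
      refine ⟨(φ b / n) • a - (φ a / n) • b, by simp [F.u3, F.v3], ?_, ?_, ?_⟩
      · rw [Q_smul_sub_smul, F.Qu, F.Qv, F.uv]
        field_simp; linarith
      · rw [B_sub_right, B_smul_right, B_smul_right, F.pu, F.pv]; ring
      · simp only [map_sub, map_smul, smul_eq_mul]; ring
  refine ⟨_, ⟨x.geodesic hu3 hQu hpu, x.hdist_geodesic hu3 hQu hpu, rfl⟩,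
    ⟨0, x.geodesic_zero hu3 hQu hpu⟩, ?_⟩
  rintro _ ⟨t, rfl⟩
  simp [H2.geodesic, geo, hx, hφ]

/-! ### The preimage of the surface -/

/-- The height of the translate by `h` of the image under `L` above the plane `x₄ = 0`. -/
def height (L : (Fin 4 → ℝ) →ₗ[ℝ] (Fin 4 → ℝ)) (h : Matrix.SpecialLinearGroup (Fin 4) ℝ) :
    (Fin 4 → ℝ) →ₗ[ℝ] ℝ :=
  LinearMap.proj 3 ∘ₗ Matrix.vecMulLinear (h : Matrix (Fin 4) (Fin 4) ℝ) ∘ₗ L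

lemma height_apply (L : (Fin 4 → ℝ) →ₗ[ℝ] (Fin 4 → ℝ))
    (h : Matrix.SpecialLinearGroup (Fin 4) ℝ) (w : Fin 4 → ℝ) :
    height L h w = (L w ᵥ* (h : Matrix (Fin 4) (Fin 4) ℝ)) 3 := rfl

lemma rho_embed_mem_V_iff {A : ℕ} {L : (Fin 4 → ℝ) →ₗ[ℝ] (Fin 4 → ℝ)} (hL : IsLorentz L)
    (x : H2) : rho A (hL.embed x) ∈ V A ↔ ∃ h ∈ Gam A, height L h x.1.1 = 0 := by
  constructor
  · rintro ⟨q, hq, e⟩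
    obtain ⟨g, hg, rfl⟩ := exists_move_of_rho_eq e.symm
    exact ⟨g, hg, hq⟩
  · rintro ⟨h, hh, e⟩
    exact ⟨(hL.embed x).move hh.1, e, rho_move _ hh⟩

lemma countable_Gam {A : ℕ} (hA : 0 < A) :
    (Gam A : Set (Matrix.SpecialLinearGroup (Fin 4) ℝ)).Countable := by
  have h : (Gam A : Set (Matrix.SpecialLinearGroup (Fin 4) ℝ)) ⊆ ⋃ n : ℕ, {h | h ∈ Gam A ∧
      (h : Matrix (Fin 4) (Fin 4) ℝ) 0 0 ≤ n} := by
    intro h hh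
    obtain ⟨n, hn⟩ := exists_nat_ge ((h : Matrix (Fin 4) (Fin 4) ℝ) 0 0)
    exact Set.mem_iUnion.mpr ⟨n, hh, hn⟩
  exact (Set.countable_iUnion fun n : ℕ => (finite_entry_le hA (n : ℝ)).countable).mono h

/-- A line in the preimage of the surface lies in the preimage of a single lift of it. -/
lemma exists_height_eq_zero_of_line {A : ℕ} (hA : 0 < A) {L : (Fin 4 → ℝ) →ₗ[ℝ] (Fin 4 → ℝ)}
    (hL : IsLorentz L) {l : Set H2} (hl : H2.IsLine l)
    (hV : ∀ x ∈ l, rho A (hL.embed x) ∈ V A) :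
    ∃ h ∈ Gam A, ∀ x ∈ l, height L h x.1.1 = 0 := by
  by_contra! hne
  -- A functional that does not vanish on the line has at most one zero there, so the countably many
  -- of them could not cover it.
  have hsub : ∀ h ∈ Gam A, {x | x ∈ l ∧ height L h x.1.1 = 0}.Subsingleton := by
    rintro h hh x ⟨hx, hx0⟩ y ⟨hy, hy0⟩
    by_contra hxy
    obtain ⟨z, hz, hz0⟩ := hne h hh
    exact hz0 (hl.subset_of_two_points (height L h) hx hy hxy hx0 hy0 z hz)
  have hcount : l.Countable := by
    refine ((countable_Gam hA).biUnion fun h hh => (hsub h hh).countable).mono fun x hx => ?_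
    obtain ⟨h, hh, e⟩ := (rho_embed_mem_V_iff hL x).mp (hV x hx)
    exact Set.mem_biUnion hh ⟨hx, e⟩
  obtain ⟨c, hc, rfl⟩ := hl
  have hinj : Function.Injective c := by
    intro s t hst
    have h1 := hc s t
    rw [hst, hc t t, sub_self, abs_zero] at h1
    exact sub_eq_zero.mp (abs_eq_zero.mp h1.symm)
  have : (Set.univ : Set ℝ).Countable := by
    rw [← Set.image_univ] at hcount
    exact Set.countable_of_injective_of_countable_image hinj.injOn hcount
  exact Cardinal.not_countable_real this

/-! ### Arithmetic of the last column and separation of lines -/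

/-- The form `x² - 7y² - 7z²` is anisotropic over the integers. -/
lemma eq_zero_of_sq_eq_seven_mul {a b c : ℤ} (h : a ^ 2 = 7 * (b ^ 2 + c ^ 2)) :
    a = 0 ∧ b = 0 ∧ c = 0 := by
  suffices H : ∀ n : ℕ, ∀ a b c : ℤ, a.natAbs = n → a ^ 2 = 7 * (b ^ 2 + c ^ 2) → a = 0 by
    have ha := H _ a b c rfl h
    subst ha
    refine ⟨rfl, ?_, ?_⟩ <;> nlinarith [sq_nonneg b, sq_nonneg c]
  intro n
  induction n using Nat.strong_induction_on with
  | _ n ih =>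
    intro a b c hn h
    have h7 : Prime (7 : ℤ) := by norm_num
    obtain ⟨a', rfl⟩ : (7 : ℤ) ∣ a := h7.dvd_of_dvd_pow ⟨_, h⟩
    have h1 : b ^ 2 + c ^ 2 = 7 * a' ^ 2 := by linarith
    -- -1 is not a square modulo 7, which drives an infinite descent on |a|.
    have h2 : ∀ x y : ZMod 7, x ^ 2 + y ^ 2 = 0 → x = 0 ∧ y = 0 := by decide
    have h3 := h2 b c (by
      have := congrArg (Int.cast : ℤ → ZMod 7) h1
      push_cast at this
      rw [this, show (7 : ZMod 7) = 0 by decide, zero_mul])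
    obtain ⟨b', rfl⟩ := (ZMod.intCast_zmod_eq_zero_iff_dvd b 7).mp h3.1
    obtain ⟨c', rfl⟩ := (ZMod.intCast_zmod_eq_zero_iff_dvd c 7).mp h3.2
    have h4 : a' ^ 2 = 7 * (b' ^ 2 + c' ^ 2) := by push_cast at h1; linarith
    by_contra hne
    have ha' : a' ≠ 0 := fun h => hne (by rw [h, mul_zero])
    refine ha' (ih a'.natAbs ?_ a' b' c' rfl h4)
    rw [← hn, Int.natAbs_mul]
    have := Int.natAbs_pos.mpr ha'
    simp only [Int.reduceAbs]
    omega

/-- The arithmetic input: either a lattice element stabilizes the plane `x₄ = 0`, or it moves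
it far away. -/
lemma last_column {A : ℕ} (hA : 0 < A) {k : Matrix.SpecialLinearGroup (Fin 4) ℝ}
    (hk : k ∈ Gam A) :
    ((k : Matrix (Fin 4) (Fin 4) ℝ) 0 3 = 0 ∧ (k : Matrix (Fin 4) (Fin 4) ℝ) 1 3 = 0 ∧
      (k : Matrix (Fin 4) (Fin 4) ℝ) 2 3 = 0 ∧ (k : Matrix (Fin 4) (Fin 4) ℝ) 3 3 ≠ 0) ∨
    (A / 7 : ℝ) + 1 ≤ (k : Matrix (Fin 4) (Fin 4) ℝ) 3 3 ^ 2 := by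
  obtain ⟨hG, γ, hγ, e⟩ := hk
  have hA0 : (0 : ℝ) < A := by exact_mod_cast hA
  have hsA : √(A : ℝ) ^ 2 = A := Real.sq_sqrt hA0.le
  have hs7 : √(7 : ℝ) ^ 2 = 7 := Real.sq_sqrt (by norm_num)
  have hA1 : √(A : ℝ) ≠ 0 := (Real.sqrt_pos.mpr hA0).ne'
  have h0 := entry_rel e 0 3
  have h1 := entry_rel e 1 3
  have h2 := entry_rel e 2 3
  have h3 := entry_rel e 3 3
  simp only [Matrix.cons_val_zero, Matrix.cons_val_one, Matrix.cons_val, one_mul] at h0 h1 h2 h3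
  have hcol := congrFun (congrFun (transpose_mul_eta_mul (G_le_SO31 hG)) 3) 3
  simp only [eta, Matrix.mul_apply, Matrix.transpose_apply, Matrix.diagonal_apply,
    Fin.sum_univ_four] at hcol
  simp at hcol
  set m := (k : Matrix (Fin 4) (Fin 4) ℝ)
  set d := (γ : Matrix (Fin 4) (Fin 4) ℤ) 3 3 with hd
  set a := (γ : Matrix (Fin 4) (Fin 4) ℤ) 0 3
  set b := (γ : Matrix (Fin 4) (Fin 4) ℤ) 1 3
  set c := (γ : Matrix (Fin 4) (Fin 4) ℤ) 2 3
  have hmd : m 3 3 = d := by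
    rw [mul_comm] at h3
    exact mul_right_cancel₀ hA1 h3
  have q0 : 7 * m 0 3 ^ 2 = A * a ^ 2 := by
    rw [← hs7, ← mul_pow, h0, mul_pow, hsA]; ring
  have q1 : m 1 3 ^ 2 = A * b ^ 2 := by rw [h1, mul_pow, hsA]; ring
  have q2 : m 2 3 ^ 2 = A * c ^ 2 := by rw [h2, mul_pow, hsA]; ring
  -- The last column of k has norm -1; this is that relation in terms of γ, multiplied by 7.
  have key : (A : ℤ) * (a ^ 2 - 7 * (b ^ 2 + c ^ 2)) = 7 * (d ^ 2 - 1) := by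
    have : (A : ℝ) * (a ^ 2 - 7 * (b ^ 2 + c ^ 2)) = 7 * (d ^ 2 - 1) := by
      rw [hmd] at hcol
      linarith
    exact_mod_cast this
  have hd0 : d ≠ 0 := by
    intro h
    have h1 := entry_mod hγ.2 3 3
    rw [← hd, h] at h1
    simp at h1
    exact absurd h1 (by decide)
  have hd2 : 1 ≤ d ^ 2 := by
    have := sq_pos_of_ne_zero hd0
    omega
  have hAz : (0 : ℤ) < A := by exact_mod_cast hA
  rcases hd2.eq_or_lt with h | h
  · left
    rw [← h, sub_self, mul_zero] at key
    have hz := (mul_eq_zero.mp key).resolve_left hAz.ne'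
    obtain ⟨ha, hb, hc⟩ := eq_zero_of_sq_eq_seven_mul (sub_eq_zero.mp hz)
    rw [ha] at q0
    rw [hb] at h1
    rw [hc] at h2
    refine ⟨?_, by simpa using h1, by simpa using h2, ?_⟩
    · simpa using q0
    · rw [hmd]; exact_mod_cast hd0
  · right
    have hpos : 0 < (A : ℤ) * (a ^ 2 - 7 * (b ^ 2 + c ^ 2)) := by rw [key]; linarith
    have h1 : 1 ≤ a ^ 2 - 7 * (b ^ 2 + c ^ 2) := pos_of_mul_pos_right hpos hAz.le
    have h2 : (A : ℤ) ≤ 7 * (d ^ 2 - 1) := by rw [← key]; nlinarith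
    have h3 : (A : ℝ) ≤ 7 * (d ^ 2 - 1) := by exact_mod_cast h2
    rw [hmd]
    linarith

/-- The distance between two planes whose normal vectors have product `-d`. -/
lemma abs_le_B_of_planes {p w v : Fin 4 → ℝ} (hp : OnH3 p) (hp3 : p 3 = 0) (hw : OnH3 w)
    (hv : Q v = -1) (hwv : B w v = 0) : |v 3| ≤ B p w := by
  -- Project to the plane x₄ = 0. Reverse Cauchy-Schwarz for w', v' reduces to v₄² ≤ 1 + w₄², and
  -- for p, w' it gives 1 + w₄² ≤ B(p, w)².
  set w' : Fin 4 → ℝ := ![w 0, w 1, w 2, 0] with hw'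
  set v' : Fin 4 → ℝ := ![v 0, v 1, v 2, 0] with hv'
  have hQw : Q w' = 1 + w 3 ^ 2 := by
    have := hw.1
    simp only [Q, hw', Matrix.cons_val_zero, Matrix.cons_val_one, Matrix.cons_val] at this ⊢
    linarith
  have hQv : Q v' = v 3 ^ 2 - 1 := by
    simp only [Q, hv', Matrix.cons_val_zero, Matrix.cons_val_one, Matrix.cons_val] at hv ⊢
    linarith
  have hBwv : B w' v' = w 3 * v 3 := by
    simp only [B, hw', hv', Matrix.cons_val_zero, Matrix.cons_val_one, Matrix.cons_val] at hwv ⊢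
    linarith
  have hBpw : B p w = B p w' := by
    simp [B, hw', hp3]
  have h1 := Q_mul_Q_le_sq (v := v') (show 0 < Q w' by rw [hQw]; positivity)
  have h2 := Q_mul_Q_le_sq (v := w') hp.Q_pos
  rw [hp.1, hQw, ← hBpw] at h2
  rw [hQw, hQv, hBwv] at h1
  apply abs_le_of_sq_le_sq _ (zero_le_one.trans (hp.one_le_B hw))
  linarith

lemma log_le_arcosh {x : ℝ} (hx : 1 ≤ x) : Real.log x ≤ Real.arcosh x := by
  rw [Real.arcosh]
  exact Real.log_le_log (by linarith) (le_add_of_nonneg_right (Real.sqrt_nonneg _))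

/-- Distinct lines in the preimage of the surface are far apart. -/
theorem le_hdist_of_lines {A : ℕ} (hA : 0 < A) {L : (Fin 4 → ℝ) →ₗ[ℝ] (Fin 4 → ℝ)} (hL : IsLorentz L)
    {l₁ l₂ : Set H2} (hl₁ : H2.IsLine l₁) (hl₂ : H2.IsLine l₂)
    (hV₁ : ∀ x ∈ l₁, rho A (hL.embed x) ∈ V A) (hV₂ : ∀ x ∈ l₂, rho A (hL.embed x) ∈ V A)
    (hne : l₁ ≠ l₂) {w : H2} (hw : rho A (hL.embed w) ∉ V A) {x y : H2} (hx : x ∈ l₁)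
    (hy : y ∈ l₂) : (1 / 2 : ℝ) * Real.log A - 1 / 2 * Real.log 7 ≤ H2.hdist x y := by
  obtain ⟨h₁, hh₁, e₁⟩ := exists_height_eq_zero_of_line hA hL hl₁ hV₁
  obtain ⟨h₂, hh₂, e₂⟩ := exists_height_eq_zero_of_line hA hL hl₂ hV₂
  have hA0 : (0 : ℝ) < A := by exact_mod_cast hA
  set k := h₁⁻¹ * h₂ with hk
  have hkG : k ∈ Gam A := mul_mem (inv_mem hh₁) hh₂
  have hmul : ∀ z : Fin 4 → ℝ, L z ᵥ* (h₂ : Matrix (Fin 4) (Fin 4) ℝ) =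
      (L z ᵥ* (h₁ : Matrix (Fin 4) (Fin 4) ℝ)) ᵥ* (k : Matrix (Fin 4) (Fin 4) ℝ) := by
    intro z
    rw [Matrix.vecMul_vecMul, ← Matrix.SpecialLinearGroup.coe_mul, hk, mul_inv_cancel_left]
  have hheight : ∀ z : Fin 4 → ℝ, height L h₂ z =
      (L z ᵥ* (h₁ : Matrix (Fin 4) (Fin 4) ℝ)) 0 * (k : Matrix (Fin 4) (Fin 4) ℝ) 0 3 +
      (L z ᵥ* (h₁ : Matrix (Fin 4) (Fin 4) ℝ)) 1 * (k : Matrix (Fin 4) (Fin 4) ℝ) 1 3 +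
      (L z ᵥ* (h₁ : Matrix (Fin 4) (Fin 4) ℝ)) 2 * (k : Matrix (Fin 4) (Fin 4) ℝ) 2 3 +
      height L h₁ z * (k : Matrix (Fin 4) (Fin 4) ℝ) 3 3 := by
    intro z
    rw [height_apply, hmul]
    simp only [Matrix.vecMul, dotProduct, Fin.sum_univ_four, height_apply]
  have hw₁ : height L h₁ w.1.1 ≠ 0 := fun h =>
    hw ((rho_embed_mem_V_iff hL w).mpr ⟨h₁, hh₁, h⟩)
  have hw₂ : height L h₂ w.1.1 ≠ 0 := fun h =>
    hw ((rho_embed_mem_V_iff hL w).mpr ⟨h₂, hh₂, h⟩)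
  rcases last_column hA hkG with ⟨c0, c1, c2, c3⟩ | hbig
  · exfalso
    have hiff : ∀ z : H2, height L h₁ z.1.1 = 0 ↔ height L h₂ z.1.1 = 0 := by
      intro z
      rw [hheight, c0, c1, c2]
      simp [c3]
    apply hne
    ext z
    constructor
    · intro hz
      exact hl₂.mem_of_apply_eq_zero _ e₂ hw₂ ((hiff z).mp (e₁ z hz))
    · intro hz
      exact hl₁.mem_of_apply_eq_zero _ e₁ hw₁ ((hiff z).mpr (e₂ z hz))
  · set m := (k : Matrix (Fin 4) (Fin 4) ℝ)
    -- The signs make B(·, v) the pairing with the last column of k, so v is normal to the translate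
    -- of the plane x₄ = 0 by k⁻¹.
    set v : Fin 4 → ℝ := ![m 0 3, -m 1 3, -m 2 3, -m 3 3] with hv
    have hQv : Q v = -1 := by
      have hcol := congrFun (congrFun (transpose_mul_eta_mul (G_le_SO31 hkG.1)) 3) 3
      simp only [eta, Matrix.mul_apply, Matrix.transpose_apply, Matrix.diagonal_apply,
        Fin.sum_univ_four] at hcol
      simp at hcol
      simp only [Q, hv, Matrix.cons_val_zero, Matrix.cons_val_one, Matrix.cons_val]
      linarith
    have hd : (A / 7 : ℝ) + 1 ≤ v 3 ^ 2 := by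
      simpa [hv] using hbig
    have hwv : B (L y.1.1 ᵥ* (h₁ : Matrix (Fin 4) (Fin 4) ℝ)) v = 0 := by
      have h := hheight y.1.1
      rw [e₂ y hy, height_apply] at h
      simp only [B, hv, Matrix.cons_val_zero, Matrix.cons_val_one, Matrix.cons_val]
      linarith
    have hB := abs_le_B_of_planes ((hL.embed x).move hh₁.1).onH3 (e₁ x hx)
      ((hL.embed y).move hh₁.1).onH3 hQv hwv
    have hBxy : B ((hL.embed x).move hh₁.1).1 ((hL.embed y).move hh₁.1).1 = B x.1.1 y.1.1 :=
      (B_vecMul (G_le_SO31 hh₁.1) _ _).trans (hL.B_map _ _ x.2 y.2)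
    rw [hBxy] at hB
    have h1 : Real.log (A / 7) ≤ 2 * Real.log (B x.1.1 y.1.1) := by
      have hsq : (A / 7 : ℝ) ≤ B x.1.1 y.1.1 ^ 2 := by
        have := pow_le_pow_left₀ (abs_nonneg _) hB 2
        rw [sq_abs] at this
        linarith
      have := Real.log_le_log (by positivity) hsq
      rwa [Real.log_pow, Nat.cast_ofNat] at this
    rw [Real.log_div hA0.ne' (by norm_num)] at h1
    have h2 := log_le_arcosh (x.onH3.one_le_B y.onH3)
    change _ ≤ Real.arcosh (B x.1.1 y.1.1)
    linarith

end HybridLattice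

end

theorem proposition5p10 :
    ∃ C : ℝ, ∀ A : ℕ, A ≡ 1 [MOD 8] →
      ∀ ζ : HybridLattice.H2 → HybridLattice.M A, HybridLattice.IsLocallyIsometric ζ →
        (∃ L : Set (Set HybridLattice.H2),
          (∀ l ∈ L, HybridLattice.H2.IsLine l) ∧ ζ ⁻¹' HybridLattice.V A = ⋃₀ L) ∧
        (¬ Set.range ζ ⊆ HybridLattice.V A →
          ∀ l₁ l₂ : Set HybridLattice.H2,
            HybridLattice.H2.IsLine l₁ → HybridLattice.H2.IsLine l₂ →
            l₁ ⊆ ζ ⁻¹' HybridLattice.V A → l₂ ⊆ ζ ⁻¹' HybridLattice.V A → l₁ ≠ l₂ →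
              (1 / 2 : ℝ) * Real.log A - C < HybridLattice.setDist HybridLattice.H2.hdist l₁ l₂) := by
  -- The separation bound holds weakly with ½ log 7; the larger constant makes it strict even after
  -- passing to the infimum.
  refine ⟨Real.log 7, fun A hmod ζ hζ => ?_⟩
  have hA : 0 < A := by
    rcases Nat.eq_zero_or_pos A with rfl | h
    · exact absurd hmod (by decide)
    · exact h
  obtain ⟨L, hL, hlift⟩ := HybridLattice.exists_lift hA hζ
  refine ⟨⟨{l | HybridLattice.H2.IsLine l ∧ l ⊆ ζ ⁻¹' HybridLattice.V A}, fun l hl => hl.1, ?_⟩,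
    ?_⟩
  · apply Set.Subset.antisymm
    · intro x hx
      rw [Set.mem_preimage, hlift, HybridLattice.rho_embed_mem_V_iff] at hx
      obtain ⟨h, hh, e⟩ := hx
      obtain ⟨l, hl, hxl, hl0⟩ := HybridLattice.H2.exists_line_of_apply_eq_zero _ x e
      refine ⟨l, ⟨hl, fun y hy => ?_⟩, hxl⟩
      rw [Set.mem_preimage, hlift, HybridLattice.rho_embed_mem_V_iff]
      exact ⟨h, hh, hl0 y hy⟩
    · exact Set.sUnion_subset fun l hl => hl.2
  · intro hrange l₁ l₂ hl₁ hl₂ hV₁ hV₂ hne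
    obtain ⟨_, ⟨w, rfl⟩, hw⟩ := Set.not_subset.mp hrange
    rw [hlift] at hw
    have hle : (1 / 2 : ℝ) * Real.log A - 1 / 2 * Real.log 7 ≤
        HybridLattice.setDist HybridLattice.H2.hdist l₁ l₂ := by
      apply le_csInf
      · obtain ⟨c₁, -, rfl⟩ := hl₁
        obtain ⟨c₂, -, rfl⟩ := hl₂
        exact ⟨_, c₁ 0, ⟨0, rfl⟩, c₂ 0, ⟨0, rfl⟩, rfl⟩
      · rintro _ ⟨x, hx, y, hy, rfl⟩
        exact HybridLattice.le_hdist_of_lines hA hL hl₁ hl₂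
          (fun z hz => hlift z ▸ hV₁ hz) (fun z hz => hlift z ▸ hV₂ hz) hne hw hx hy
    have h7 : 0 < Real.log 7 := Real.log_pos (by norm_num)
    linarith
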